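/- \textbf{Setting.} There are $n$ experts and independent real signals $X_T$, $T\subseteq[n]$, with $\mathbb E[X_T]=0$, $\mathrm{Var}(X_T)<\infty$, $X_\emptyset=0$ and $\mathrm{Var}(X_T)>0$ for at least one $T$; the joint law is the prior $\mathcal D=(\mathcal D_T)_T$. Expert $i$ observes $\mathcal S_i=(X_T)_{T\ni i}$ and knows $\mathcal D$, and $Y=\sum_T X_T$. A query $Q$ is put to an expert $i=\mathrm{agent}(Q)$ and is a real function of $(\mathcal S_i,\mathcal D)$. It is elicitable with respect to a family $R$ of random variables if for some payment function $\pi(r,R)$ its answer is, for every $\mathcal D$, almost surely the unique maximizer over $r\in\mathbb R$ of $\mathbb E[\pi(r,R)\mid\mathcal S_i]$. A finite list $\mathcal Q$ of queries is DAG-elicited by a directed acyclic graph $G$ on $\mathcal Q\cup\{Y\}$ if $Y$ is the unique sink of $G$ and each $Q\in\mathcal Q$ is elicitable with respect to its set $N_G(Q)$ of out-neighbours. The order complexity of $\mathcal Q$ is the minimum, over all $G$ that DAG-elicit $\mathcal Q$, of the maximal length of a directed path in $G$ from a query to $Y$; its agent complexity is the minimum over such $G$ of $\max_{Q}|\{\mathrm{agent}(Q'):Q'\in\mathcal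 Q \text{ reachable from } Q \text{ in } G\}|$ (each $Q$ is reachable from itself). A linear aggregation rule is a pair $(\mathcal Q,f)$ such that, for some $G$ that DAG-elicits $\mathcal Q$ and some real constants $\alpha_{Q,Q'},\beta_Q$ (independent of $\mathcal D$), each $Q\in\mathcal Q$ equals $\mathbb E\big[\sum_{Q'\in N_G(Q)}\alpha_{Q,Q'}Q'\mid\mathcal S_{\mathrm{agent}(Q)}\big]$ and $f(\mathcal Q)=\sum_{Q}\beta_Q Q$. A randomized linear aggregation rule draws a linear aggregation rule at random, independently of the signals; it implements the approximator $A=f(\mathcal Q)$. Let $\mathcal A_d^{\mathrm{lin}}$ be the set of approximators implemented by randomized linear aggregation rules almost all of whose query lists have agent complexity at most $d$ and order complexity at most $d$. Put $$\mathrm{error}(A)=\sup_{\mathcal D}\frac{\mathbb E[(A-Y)^2]}{\sum_T\mathrm{Var}(X_T)},\qquad E(n,d)=\inf_{A\in\mathcal A_d^{\mathrm{lin}}}\mathrm{error}(A).$$ \textbf{Theorem.} The infimum $E(n,d)$ is finite and attained for all $n,d$. For every sequence $d=d(n)$ of natural numbers, as $n\to\infty$: \begin{itemize} \item if $d=o(\sqrt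 n)$, then $E(n,d)=1-\Theta(d^2/n)$; \item if $d=\Theta(\sqrt n)$, then $E(n,d)$ is bounded away from $0$ and $1$: there are constants $0<a\le b<1$ with $a\le E(n,d)\le b$ for all large $n$; and if moreover $d/\sqrt n$ converges to some $c\in(0,\infty)$, then $\lim_{n\to\infty}E(n,d)$ exists and lies in $(0,1)$; \item if $d=\omega(\sqrt n)$, then $E(n,d)=O\big(e^{-4d/\sqrt n}\big)$. \end{itemize} -/

import Mathlib

open MeasureTheory ProbabilityTheory Filter Asymptotics
open scoped Topology ENNReal

/-! ### The partial information model -/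

/-- A prior of the partial information model with `n` experts: independent signals `X_T`, one for
each set `T` of experts, where `X_T` has law `dist T`, mean zero and finite variance; `X_∅ = 0`, and
some signal has positive variance. -/
structure Prior (n : ℕ) where
  dist : Finset (Fin n) → Measure ℝ
  isProb : ∀ T, IsProbabilityMeasure (dist T)
  memLp_two : ∀ T, MemLp (fun x : ℝ => x) 2 (dist T)
  mean_zero : ∀ T, ∫ x, x ∂(dist T) = 0
  dist_empty : dist ∅ = Measure.dirac 0
  exists_var_pos : ∃ T, 0 < variance (fun x : ℝ => x) (dist T)

/-- A realization of all the signals `X_T`; the random variable `X_T` is the coordinate `T`. -/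
abbrev Signals (n : ℕ) : Type := Finset (Fin n) → ℝ

/-- The joint law of the independent signals `(X_T)_T`. -/
noncomputable def Prior.law {n : ℕ} (D : Prior n) : Measure (Signals n) := Measure.pi D.dist

instance Prior.instIsProbDist {n : ℕ} (D : Prior n) (T : Finset (Fin n)) :
    IsProbabilityMeasure (D.dist T) := D.isProb T

instance Prior.instIsProbLaw {n : ℕ} (D : Prior n) : IsProbabilityMeasure D.law := by
  unfold Prior.law; infer_instance

/-- The quantity of interest, `Y = ∑_T X_T`. -/
noncomputable def target {n : ℕ} (x : Signals n) : ℝ := ∑ T, x T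

/-- What expert `i` observes: the signals `X_T` with `i ∈ T`. -/
abbrev AgentSignals {n : ℕ} (i : Fin n) : Type := {T : Finset (Fin n) // i ∈ T} → ℝ

/-- The observation `S_i` of expert `i`. -/
def observe {n : ℕ} (i : Fin n) (x : Signals n) : AgentSignals i := fun T => x T.1

/-- The sigma-algebra generated by the observation of expert `i`. -/
abbrev agentSigma {n : ℕ} (i : Fin n) : MeasurableSpace (Signals n) :=
  MeasurableSpace.comap (observe i) inferInstance

/-! ### Queries, elicitability and DAG-elicitable query lists -/

/-- A query: it is put to an expert, and maps the information of that expert and the prior to a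
real number. -/
structure Query (n : ℕ) where
  agent : Fin n
  answer : Prior n → AgentSignals agent → ℝ
  measurable_answer : ∀ D, Measurable (answer D)

/-- The output of a query as a random variable. -/
def Query.out {n : ℕ} (Q : Query n) (D : Prior n) (x : Signals n) : ℝ :=
  Q.answer D (observe Q.agent x)

/-- `Q` is elicitable with respect to a countable family `R` of random variables: for some payment
`π (r, R)`, the truthful answer is almost surely the unique maximizer over all reports `r` of the
expected payment conditional on the information of the expert. -/
def Elicitable {n : ℕ} {κ : Type} [Countable κ] (Q : Query n)
    (R : κ → Prior n → Signals n → ℝ) : Prop :=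
  ∃ π : ℝ → (κ → ℝ) → ℝ, ∀ D : Prior n, ∀ᵐ x ∂D.law,
    let ν : Measure (κ → ℝ) :=
      condDistrib (fun y v => R v D y) (observe Q.agent) D.law (observe Q.agent x)
    (∀ r : ℝ, Integrable (π r) ν) ∧
      ∀ r : ℝ, r ≠ Q.out D x → ∫ z, π r z ∂ν < ∫ z, π (Q.out D x) z ∂ν

/-- The random variable at a node of a graph on the node set `𝒬 ∪ {Y}`: `some j` is the `j`-th
query of the list and `none` is `Y`. -/
noncomputable def nodeVar {n m : ℕ} (𝒬 : Fin m → Query n) :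
    Option (Fin m) → Prior n → Signals n → ℝ
  | some j => (𝒬 j).out
  | none => fun _ => target

/-- The directed graph `G` on `𝒬 ∪ {Y}` DAG-elicits the list `𝒬`: it is acyclic, `Y` is its unique
sink, and each query is elicitable with respect to its out-neighbours. -/
def DAGElicits {n m : ℕ} (𝒬 : Fin m → Query n) (G : Digraph (Option (Fin m))) : Prop :=
  (∀ v, ¬ Relation.TransGen G.Adj v v) ∧
  (∀ v, (∀ w, ¬ G.Adj v w) ↔ v = none) ∧
  ∀ j : Fin m, Elicitable (𝒬 j)
    (fun v : {v : Option (Fin m) // G.Adj (some j) v} => nodeVar 𝒬 v.1)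

/-! ### Order complexity and agent complexity -/

/-- The order of the `j`-th query under `G`: the maximal length of a directed path to `Y`. (In an
acyclic graph each directed walk is a path.) -/
noncomputable def orderIn {m : ℕ} (G : Digraph (Option (Fin m))) (j : Fin m) : ℕ∞ :=
  sSup {k : ℕ∞ | ∃ (l : ℕ) (w : ℕ → Option (Fin m)), k = (l : ℕ∞) ∧ w 0 = some j ∧ w l = none ∧
    ∀ i < l, G.Adj (w i) (w (i + 1))}

/-- The experts whose beliefs are relevant to the `j`-th query under `G`: those asked some query
that is reachable from it (itself included). -/
def relevantAgents {n m : ℕ} (𝒬 : Fin m → Query n) (G : Digraph (Option (Fin m))) (j : Fin m) :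
    Set (Fin n) :=
  {i | ∃ k : Fin m, Relation.ReflTransGen G.Adj (some j) (some k) ∧ (𝒬 k).agent = i}

/-- Order complexity of a query list (`⊤` if it is not DAG-elicitable). -/
noncomputable def orderComplexity {n m : ℕ} (𝒬 : Fin m → Query n) : ℕ∞ :=
  ⨅ (G : Digraph (Option (Fin m))) (_ : DAGElicits 𝒬 G), ⨆ j : Fin m, orderIn G j

/-- Agent complexity of a query list (`⊤` if it is not DAG-elicitable). -/
noncomputable def agentComplexity {n m : ℕ} (𝒬 : Fin m → Query n) : ℕ∞ :=
  ⨅ (G : Digraph (Option (Fin m))) (_ : DAGElicits 𝒬 G),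
    ⨆ j : Fin m, (relevantAgents 𝒬 G j).encard

/-! ### Aggregation rules -/

/-- A deterministic aggregation rule: a finite list of queries and an aggregation function. -/
structure AggregationRule (n : ℕ) where
  size : ℕ
  query : Fin size → Query n
  aggregate : (Fin size → ℝ) → ℝ

/-- The output `f(𝒬)` of a deterministic aggregation rule. -/
def AggregationRule.output {n : ℕ} (R : AggregationRule n) (D : Prior n) (x : Signals n) : ℝ :=
  R.aggregate (fun j => (R.query j).out D x)

open Classical in
/-- A linear aggregation rule: for some graph that DAG-elicits the query list, each query is the
conditional expectation, given the information of the expert asked, of a linear combination of its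
out-neighbours, with coefficients that do not depend on the prior; and the aggregation function is
linear. -/
def AggregationRule.IsLinear {n : ℕ} (R : AggregationRule n) : Prop :=
  (∃ G : Digraph (Option (Fin R.size)), DAGElicits R.query G ∧
    ∃ α : Fin R.size → Option (Fin R.size) → ℝ, ∀ (j : Fin R.size) (D : Prior n),
      (R.query j).out D =ᵐ[D.law]
        (D.law)[fun x => ∑ v with G.Adj (some j) v, α j v * nodeVar R.query v D x |
          agentSigma (R.query j).agent]) ∧
  ∃ β : Fin R.size → ℝ, ∀ y, R.aggregate y = ∑ j, β j * y j

/-- A random context: a probability space, independent of the signals, from which the principal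
draws the aggregation rule. -/
structure RandomContext where
  Ω : Type
  [instMeasurableSpace : MeasurableSpace Ω]
  P : Measure Ω
  [instIsProb : IsProbabilityMeasure P]

attribute [instance] RandomContext.instMeasurableSpace RandomContext.instIsProb

/-- A randomized aggregation rule over a random context. -/
structure RandomizedRule (n : ℕ) (Z : RandomContext) where
  rule : Z.Ω → AggregationRule n
  measurable_output : ∀ D : Prior n,
    Measurable (fun p : Z.Ω × Signals n => (rule p.1).output D p.2)

/-- An approximator of `Y`, as a random variable on the context and the signals for each prior. -/
abbrev Approximator (n : ℕ) (Z : RandomContext) : Type := Prior n → Z.Ω × Signals n → ℝ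

/-- `A` is implemented by a randomized rule: it is almost surely its output, for each prior. -/
def RandomizedRule.Implements {n : ℕ} {Z : RandomContext} (R : RandomizedRule n Z)
    (A : Approximator n Z) : Prop :=
  ∀ D : Prior n, ∀ᵐ p ∂(Z.P.prod D.law), A D p = (R.rule p.1).output D p.2

/-- The approximators that are implemented by a randomized linear aggregation rule of agent and
order complexity at most `d`. -/
def linApproximators (n d : ℕ) (Z : RandomContext) : Set (Approximator n Z) :=
  {A | ∃ R : RandomizedRule n Z, R.Implements A ∧
    ∀ᵐ z ∂Z.P, (R.rule z).IsLinear ∧ agentComplexity (R.rule z).query ≤ d ∧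
      orderComplexity (R.rule z).query ≤ d}

/-! ### Error -/

/-- The expected squared error of an approximator under the prior `D`. -/
noncomputable def loss {n : ℕ} {Z : RandomContext} (A : Approximator n Z) (D : Prior n) : ℝ≥0∞ :=
  ∫⁻ p, ENNReal.ofReal ((A D p - target p.2) ^ 2) ∂(Z.P.prod D.law)

/-- The worst-case error of an approximator: the maximum over all priors of the expected squared
error divided by the variance of `Y`. -/
noncomputable def worstError {n : ℕ} {Z : RandomContext} (A : Approximator n Z) : ℝ≥0∞ :=
  ⨆ D : Prior n, loss A D / ENNReal.ofReal (∑ T, variance (fun x : ℝ => x) (D.dist T))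

/-- The best worst-case error of the approximators that are implemented by randomized linear
aggregation rules of agent and order complexity at most `d`. -/
noncomputable def optimalError (n d : ℕ) : ℝ≥0∞ :=
  ⨅ (Z : RandomContext) (A : Approximator n Z) (_ : A ∈ linApproximators n d Z), worstError A

/-! The problem reduces to an extremal problem for polynomials in one variable: `optimalError n d`
equals `minDev n d ^ 2` (`optimalError_eq`), where `minDev n d` is the least possible value of `max
|p(k)|` over `k = 1, …, n`, for `p` of degree at most `d` with `p(0) = 1`.

Conditioning on expert `i` deletes from a linear form the signals that `i` does not observe, so the
answers in a linear rule are linear forms. Elicitability forces the coefficients of an answer into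
the span of the restrictions to `i` of those of its references. Hence, in a list of agent complexity
at most `d`, the coefficient of `X_T` is a polynomial in `T` of degree at most `d` without constant
term. Under such coefficients `c` the loss is `∑ (c T - 1)² Var X_T`. Averaging over sets of equal
size turns `c` into a polynomial in `|T|` vanishing at `0`. A dual functional of the extremal
problem then gives one prior that is bad for every rule, hence also for random ones
(`minDev_sq_le_worstError`). Conversely, nested forecasts along small sets, weighted by the Newton
expansion of `1 - p`, realize the coefficients `1 - p(|T|)` (`exists_worstError_le`).

It remains to estimate `minDev`. Chebyshev polynomials on `[1, n]` give the upper bounds. The lower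
bounds rest on `exists_norm_eval_le_of_integer_points`: a polynomial of degree `O(√n)` bounded at
the integers is bounded on all of `[0, n]`, so that the Bernstein-Walsh inequality controls its
growth and its derivative. For the limit, an extremal polynomial at scale `n` is composed with a
Chebyshev polynomial to obtain an almost extremal competitor at a much larger scale `m`
(`minDev_comparison`). -/

/-! ### Polynomials bounded on an interval, at complex points -/

section BernsteinWalsh

open Polynomial Complex

/-- The Joukowski pull-back `w ^ d * P ((n / 4) * (2 - w - w⁻¹))`, as a polynomial function. -/
noncomputable def joukowskiPullback (P : ℂ[X]) (d : ℕ) (n : ℝ) (w : ℂ) : ℂ :=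
  ∑ i ∈ Finset.range (d + 1), P.coeff i * w ^ (d - i) * ((n / 4) * (2 * w - w ^ 2 - 1)) ^ i

lemma joukowskiPullback_eq {P : ℂ[X]} {d : ℕ} (hd : P.natDegree ≤ d) (n : ℝ) {w : ℂ} (hw : w ≠ 0) :
    joukowskiPullback P d n w = w ^ d * P.eval ((n / 4) * (2 - w - w⁻¹)) := by
  rw [joukowskiPullback, eval_eq_sum_range' (Nat.lt_succ_of_le hd), Finset.mul_sum]
  refine Finset.sum_congr rfl fun i hi => ?_
  have hi' : i ≤ d := Nat.lt_succ_iff.mp (Finset.mem_range.mp hi)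
  have h1 : (n / 4 : ℂ) * (2 * w - w ^ 2 - 1) = w * ((n / 4) * (2 - w - w⁻¹)) := by
    field_simp
  rw [h1, mul_pow, ← Nat.sub_add_cancel hi', pow_add]
  simp only [Nat.add_sub_cancel]
  ring

/-- On the unit circle `w + w⁻¹ = 2 Re w`, so the argument of `P` is a point of `[0, n]`; the
maximum principle carries the bound into the disc. -/
lemma norm_joukowskiPullback_le {P : ℂ[X]} {d : ℕ} (hd : P.natDegree ≤ d) {n S : ℝ} (hn : 0 < n)
    (hS : ∀ x ∈ Set.Icc 0 n, ‖P.eval (x : ℂ)‖ ≤ S) {w : ℂ} (hw : ‖w‖ ≤ 1) :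
    ‖joukowskiPullback P d n w‖ ≤ S := by
  have hdiff : Differentiable ℂ (joukowskiPullback P d n) := by
    unfold joukowskiPullback
    fun_prop
  refine Complex.norm_le_of_forall_mem_frontier_norm_le (U := Metric.ball 0 1)
    Metric.isBounded_ball hdiff.diffContOnCl (fun v hv => ?_) ?_
  · rw [frontier_ball _ one_ne_zero, mem_sphere_zero_iff_norm] at hv
    have hv0 : v ≠ 0 := by
      rintro rfl
      simp at hv
    rw [joukowskiPullback_eq hd n hv0, norm_mul, norm_pow, hv, one_pow, one_mul]
    have hre : (n / 4 : ℂ) * (2 - v - v⁻¹) = ((n / 2 * (1 - v.re) : ℝ) : ℂ) := by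
      rw [Complex.inv_def, Complex.normSq_eq_norm_sq, hv]
      apply Complex.ext <;> simp
      ring
    rw [hre]
    refine hS _ ⟨?_, ?_⟩
    · have := (abs_le.mp (hv ▸ Complex.abs_re_le_norm v)).2
      exact mul_nonneg (by positivity) (by linarith)
    · have := (abs_le.mp (hv ▸ Complex.abs_re_le_norm v)).1
      nlinarith
  · rw [closure_ball _ one_ne_zero]
    simpa using hw

/-- The two roots of `w² - b w + 1` have product `1`, so one of them lies in the closed unit disc.
-/
lemma exists_joukowski_preimage (b : ℂ) : ∃ w : ℂ, w ≠ 0 ∧ ‖w‖ ≤ 1 ∧ w + w⁻¹ = b := by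
  obtain ⟨s, hs⟩ := IsAlgClosed.exists_pow_nat_eq (b ^ 2 - 4) (n := 2) two_pos
  have hprod : ((b + s) / 2) * ((b - s) / 2) = 1 := by
    linear_combination (-1 / 4 : ℂ) * hs
  have h1 : (b + s) / 2 ≠ 0 := left_ne_zero_of_mul_eq_one hprod
  have h2 : (b - s) / 2 ≠ 0 := right_ne_zero_of_mul_eq_one hprod
  have hinv : ((b + s) / 2)⁻¹ = (b - s) / 2 := inv_eq_of_mul_eq_one_right hprod
  have hinv' : ((b - s) / 2)⁻¹ = (b + s) / 2 := by rw [← hinv, inv_inv]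
  by_cases h : ‖(b + s) / 2‖ ≤ 1
  · exact ⟨_, h1, h, by rw [hinv]; ring⟩
  · refine ⟨_, h2, ?_, by rw [hinv']; ring⟩
    rw [← hinv, norm_inv]
    exact inv_le_one_of_one_le₀ (not_le.mp h).le

/-- **Bernstein-Walsh inequality**: the growth of a polynomial of degree `d` that is bounded on
`[0, n]`, in terms of the ellipses with foci `0` and `n`. -/
theorem norm_eval_le_mul_exp {P : ℂ[X]} {d : ℕ} (hd : P.natDegree ≤ d) {n S t : ℝ} (hn : 0 < n)
    (hS : ∀ x ∈ Set.Icc 0 n, ‖P.eval (x : ℂ)‖ ≤ S) (ht : 0 ≤ t) {z : ℂ}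
    (hz : ‖z‖ + ‖n - z‖ ≤ n * Real.cosh t) : ‖P.eval z‖ ≤ S * Real.exp (d * t) := by
  have hn' : (n : ℂ) ≠ 0 := by exact_mod_cast hn.ne'
  obtain ⟨w, hw0, hw1, hw⟩ := exists_joukowski_preimage (2 - 4 * z / n)
  have hzw : z = (n / 4) * (2 - w - w⁻¹) := by
    have : (2 - w - w⁻¹ : ℂ) = 4 * z / n := by linear_combination -hw
    rw [this]
    field_simp
  set r := ‖w‖ with hr
  have hr0 : 0 < r := norm_pos_iff.mpr hw0
  -- The focal distances are `(n / 4)‖w ∓ 1‖² / r`; by the parallelogram law their sum depends only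
  -- on `r`, so circles in `w` correspond to ellipses in `z`.
  have hsum : ‖z‖ + ‖n - z‖ = n * ((r + r⁻¹) / 2) := by
    have e1 : z = -(n / 4) * (w - 1) ^ 2 / w := by
      rw [hzw]; field_simp; ring
    have e2 : n - z = (n / 4) * (w + 1) ^ 2 / w := by
      rw [hzw]; field_simp; ring
    have hpar : ‖w - 1‖ ^ 2 + ‖w + 1‖ ^ 2 = 2 * (r ^ 2 + 1) := by
      have := parallelogram_law_with_norm ℝ w 1
      rw [norm_one] at this
      nlinarith
    rw [e2, norm_div, e1]
    simp only [norm_div, norm_mul, norm_neg, norm_pow, Complex.norm_real, Real.norm_eq_abs,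
      abs_of_pos hn, Complex.norm_ofNat, ← hr]
    rw [← add_div, ← mul_add, hpar]
    field_simp
    ring
  have hlog : -Real.log r ≤ t := by
    have h1 : Real.cosh (-Real.log r) = (r + r⁻¹) / 2 := by
      rw [Real.cosh_neg, Real.cosh_log hr0]
    have h2 : Real.cosh (-Real.log r) ≤ Real.cosh t := by
      rw [h1]
      rw [hsum] at hz
      exact le_of_mul_le_mul_left hz hn
    rw [Real.cosh_le_cosh] at h2
    exact (le_abs_self _).trans (h2.trans (abs_of_nonneg ht).le)
  have hG := norm_joukowskiPullback_le hd hn hS hw1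
  rw [joukowskiPullback_eq hd n hw0, ← hzw, norm_mul, norm_pow, ← hr] at hG
  have hS0 : 0 ≤ S := (norm_nonneg _).trans (hS 0 ⟨le_rfl, hn.le⟩)
  have hexp : 1 ≤ r ^ d * Real.exp (d * t) := by
    have : r ^ d = Real.exp (d * Real.log r) := by
      rw [mul_comm, Real.exp_mul, Real.exp_log hr0, Real.rpow_natCast]
    rw [this, ← Real.exp_add, ← mul_add]
    exact Real.one_le_exp (mul_nonneg (Nat.cast_nonneg _) (by linarith))
  calc ‖P.eval z‖ ≤ ‖P.eval z‖ * (r ^ d * Real.exp (d * t)) :=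
        le_mul_of_one_le_right (norm_nonneg _) hexp
    _ = (r ^ d * ‖P.eval z‖) * Real.exp (d * t) := by ring
    _ ≤ S * Real.exp (d * t) := by gcongr

lemma one_add_sq_div_two_le_cosh (t : ℝ) : 1 + t ^ 2 / 2 ≤ Real.cosh t := by
  have h := Real.cosh_sq (t / 2)
  have h2 : Real.cosh t = Real.cosh (t / 2) ^ 2 + Real.sinh (t / 2) ^ 2 := by
    rw [← Real.cosh_two_mul]; congr 1; ring
  have h3 : (t / 2) ^ 2 ≤ Real.sinh (t / 2) ^ 2 := by
    rw [sq_le_sq]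
    rcases le_total 0 (t / 2) with h0 | h0
    · rw [abs_of_nonneg h0]
      exact (Real.self_le_sinh_iff.mpr h0).trans (le_abs_self _)
    · rw [abs_of_nonpos h0]
      have := Real.sinh_le_self_iff.mpr h0
      exact (neg_le_neg this).trans (neg_le_abs _)
  nlinarith

/-- Taking `t = 2√(ρ/n)` suffices, because `cosh t ≥ 1 + t²/2 = 1 + 2ρ/n`. -/
lemma norm_eval_le_of_norm_add_norm_le {P : ℂ[X]} {d : ℕ} (hd : P.natDegree ≤ d) {n S ρ : ℝ}
    (hn : 0 < n) (hS : ∀ x ∈ Set.Icc 0 n, ‖P.eval (x : ℂ)‖ ≤ S) (hρ : 0 ≤ ρ) {z : ℂ}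
    (hz : ‖z‖ + ‖n - z‖ ≤ n + 2 * ρ) : ‖P.eval z‖ ≤ S * Real.exp (2 * d * √(ρ / n)) := by
  have := norm_eval_le_mul_exp hd hn hS (t := 2 * √(ρ / n)) (by positivity) (z := z) ?_
  · rwa [← mul_assoc, mul_comm (d : ℝ) 2] at this
  · refine hz.trans ?_
    have h := one_add_sq_div_two_le_cosh (2 * √(ρ / n))
    rw [mul_pow, Real.sq_sqrt (by positivity)] at h
    calc n + 2 * ρ = n * (1 + 2 ^ 2 * (ρ / n) / 2) := by field_simp
      _ ≤ _ := by gcongr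

lemma norm_eval_le_of_dist_le {P : ℂ[X]} {d : ℕ} (hd : P.natDegree ≤ d) {n S ρ : ℝ}
    (hn : 0 < n) (hS : ∀ x ∈ Set.Icc 0 n, ‖P.eval (x : ℂ)‖ ≤ S) {x : ℝ} (hx : x ∈ Set.Icc 0 n)
    {z : ℂ} (hz : ‖z - x‖ ≤ ρ) : ‖P.eval z‖ ≤ S * Real.exp (2 * d * √(ρ / n)) := by
  refine norm_eval_le_of_norm_add_norm_le hd hn hS ((norm_nonneg _).trans hz) ?_
  have h1 : ‖z‖ ≤ ρ + x := by
    calc ‖z‖ = ‖(z - x) + x‖ := by ring_nf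
      _ ≤ ‖z - x‖ + ‖(x : ℂ)‖ := norm_add_le _ _
      _ ≤ ρ + x := by
        rw [Complex.norm_real, Real.norm_of_nonneg hx.1]; gcongr
  have h2 : ‖n - z‖ ≤ ρ + (n - x) := by
    calc ‖n - z‖ = ‖-(z - x) + ((n - x : ℝ) : ℂ)‖ := by push_cast; ring_nf
      _ ≤ ‖z - x‖ + ‖((n - x : ℝ) : ℂ)‖ := by
        rw [← norm_neg (z - x)]; exact norm_add_le _ _
      _ ≤ ρ + (n - x) := by
        rw [Complex.norm_real, Real.norm_of_nonneg (by linarith [hx.2])]; gcongr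
  linarith

lemma norm_eval_derivative_le {P : ℂ[X]} {c : ℂ} {ρ B : ℝ} (hρ : 0 < ρ)
    (h : ∀ z, ‖z - c‖ = ρ → ‖P.eval z‖ ≤ B) : ‖P.derivative.eval c‖ ≤ B / ρ := by
  rw [← Polynomial.deriv]
  refine norm_deriv_le_of_forall_mem_sphere_norm_le hρ P.differentiable.diffContOnCl ?_
  intro z hz
  exact h z (by rwa [mem_sphere_iff_norm] at hz)

/-- A Markov type inequality. -/
lemma norm_eval_derivative_le_edge {P : ℂ[X]} {d : ℕ} (hd : P.natDegree ≤ d) {n S ρ : ℝ}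
    (hn : 0 < n) (hS : ∀ x ∈ Set.Icc 0 n, ‖P.eval (x : ℂ)‖ ≤ S) (hρ : 0 < ρ)
    {x : ℝ} (hx : x ∈ Set.Icc 0 n) :
    ‖P.derivative.eval (x : ℂ)‖ ≤ S * Real.exp (2 * d * √(ρ / n)) / ρ :=
  norm_eval_derivative_le hρ fun _ hz => norm_eval_le_of_dist_le hd hn hS hx hz.le

/-- Since `√K ≤ K / 2`, one has `(Im u)² ≤ K ≤ 2 (x + Re u)`. Applied at both foci, this puts the
disc of radius `√K` around a point of `[K, n - K]` inside the ellipse with `ρ = 1`; a Cauchy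
estimate on so large a disc gains the factor `1 / √K`. -/
lemma norm_le_re_add_one {K : ℝ} (hK : 4 ≤ K) {x : ℝ} (hx : K ≤ x) {u : ℂ} (hu : ‖u‖ = √K) :
    ‖(x : ℂ) + u‖ ≤ x + u.re + 1 := by
  have hsq : √K ^ 2 = K := Real.sq_sqrt (by linarith)
  have hre : |u.re| ≤ √K := hu ▸ Complex.abs_re_le_norm u
  have h2 : √K ≤ K / 2 := by
    have : 2 ≤ √K := Real.le_sqrt_of_sq_le (by linarith)
    nlinarith
  have h3 : K / 2 ≤ x + u.re := by linarith [(abs_le.mp hre).1]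
  have h4 : u.re ^ 2 + u.im ^ 2 = K := by
    rw [← hsq, ← hu, ← Complex.normSq_eq_norm_sq, Complex.normSq_apply]; ring
  rw [← abs_of_nonneg (by linarith : (0:ℝ) ≤ x + u.re + 1), ← abs_norm, ← sq_le_sq,
    ← Complex.normSq_eq_norm_sq, Complex.normSq_apply]
  simp only [Complex.add_re, Complex.add_im, Complex.ofReal_re, Complex.ofReal_im]
  nlinarith

/-- A Bernstein type inequality. -/
lemma norm_eval_derivative_le_middle {P : ℂ[X]} {d : ℕ} (hd : P.natDegree ≤ d) {n S K : ℝ}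
    (hS : ∀ x ∈ Set.Icc 0 n, ‖P.eval (x : ℂ)‖ ≤ S) (hK : 4 ≤ K)
    {x : ℝ} (hx : x ∈ Set.Icc K (n - K)) :
    ‖P.derivative.eval (x : ℂ)‖ ≤ S * Real.exp (2 * d * √(1 / n)) / √K := by
  have hn : 0 < n := by linarith [hx.1, hx.2]
  refine norm_eval_derivative_le (Real.sqrt_pos.mpr (by linarith)) fun z hz => ?_
  refine norm_eval_le_of_norm_add_norm_le hd hn hS zero_le_one ?_
  have h1 := norm_le_re_add_one hK hx.1 hz
  have h2 := norm_le_re_add_one hK (x := n - x) (by linarith [hx.2]) (u := -(z - x))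
    (by rw [norm_neg, hz])
  have e1 : (x : ℂ) + (z - x) = z := by ring
  have e2 : ((n - x : ℝ) : ℂ) + -(z - x) = n - z := by push_cast; ring
  rw [e1] at h1
  rw [e2] at h2
  simp only [Complex.neg_re] at h2
  linarith

lemma norm_eval_sub_le_of_derivative {P : ℂ[X]} {a b L : ℝ}
    (h : ∀ x ∈ Set.Icc a b, ‖P.derivative.eval (x : ℂ)‖ ≤ L) {x y : ℝ} (hx : x ∈ Set.Icc a b)
    (hy : y ∈ Set.Icc a b) : ‖P.eval (x : ℂ) - P.eval (y : ℂ)‖ ≤ L * |x - y| := by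
  have := (convex_Icc a b).norm_image_sub_le_of_norm_hasDerivWithin_le
    (f := fun t : ℝ => P.eval (t : ℂ)) (f' := fun t : ℝ => P.derivative.eval (t : ℂ)) (C := L)
    (fun t _ => ((P.hasDerivAt (t : ℂ)).comp_ofReal).hasDerivWithinAt) h hy hx
  simpa using this

end BernsteinWalsh

/-! ### Polynomials bounded at integers -/

section IntegerPoints

open Polynomial Complex

/-- The Lagrange basis of the fixed nodes `0, …, N - 1` is bounded on a compact disc, so `Λ` depends
on `N` and `R` only, not on the data. -/
lemma exists_interpolation_bound (N : ℕ) (R : ℝ) : ∃ Λ : ℝ, 1 ≤ Λ ∧ ∀ (y : ℕ → ℂ) (B : ℝ), 0 ≤ B →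
    (∀ j < N, ‖y j‖ ≤ B) → ∃ I : ℂ[X], (∀ j < N, I.eval (j : ℂ) = y j) ∧
      ∀ z : ℂ, ‖z‖ ≤ R → ‖I.eval z‖ ≤ Λ * B := by
  have hb : ∀ j, ∃ c : ℝ, ∀ z ∈ Metric.closedBall (0 : ℂ) R,
      ‖(Lagrange.basis (Finset.range N) (fun j : ℕ => (j : ℂ)) j).eval z‖ ≤ c := fun j =>
    (isCompact_closedBall 0 R).exists_bound_of_continuousOn
      (Polynomial.continuous _).continuousOn
  choose c hc using hb
  refine ⟨1 + ∑ j ∈ Finset.range N, |c j|, ?_, fun y B hB hy => ?_⟩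
  · linarith [Finset.sum_nonneg fun j (_ : j ∈ Finset.range N) => abs_nonneg (c j)]
  refine ⟨Lagrange.interpolate (Finset.range N) (fun j : ℕ => (j : ℂ)) y, fun j hj => ?_,
    fun z hz => ?_⟩
  · exact Lagrange.eval_interpolate_at_node (v := fun j : ℕ => (j : ℂ)) y
      (Nat.cast_injective.injOn) (Finset.mem_range.mpr hj)
  · rw [Lagrange.interpolate_apply, eval_finsetSum]
    refine (norm_sum_le _ _).trans ?_
    calc ∑ j ∈ Finset.range N, ‖(C (y j) *
          Lagrange.basis (Finset.range N) (fun j : ℕ => (j : ℂ)) j).eval z‖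
        ≤ ∑ j ∈ Finset.range N, |c j| * B := by
          refine Finset.sum_le_sum fun j hj => ?_
          rw [eval_mul, eval_C, norm_mul, mul_comm]
          have h1 := (hc j z (by simpa using hz)).trans (le_abs_self _)
          have h2 := hy j (Finset.mem_range.mp hj)
          gcongr
      _ ≤ (1 + ∑ j ∈ Finset.range N, |c j|) * B := by
          rw [← Finset.sum_mul]; gcongr; linarith

/-- A Schwarz lemma: divide `E` by `∏ (z - j)`, whose factors have modulus at least `4N` on the
circle of radius `5N` and at most `N` on `[0, N]`. -/
lemma norm_eval_le_of_vanishing {E : ℂ[X]} {N : ℕ} (hN : 0 < N) {T : ℝ}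
    (h0 : ∀ j < N, E.eval (j : ℂ) = 0) (hT : ∀ z : ℂ, ‖z‖ = 5 * N → ‖E.eval z‖ ≤ T)
    {x : ℝ} (hx : x ∈ Set.Icc 0 (N : ℝ)) : ‖E.eval (x : ℂ)‖ ≤ T / 4 ^ N := by
  have hNr : (0 : ℝ) < N := Nat.cast_pos.mpr hN
  have hdvd : ∏ j ∈ Finset.range N, (X - C (j : ℂ)) ∣ E := by
    refine Finset.prod_dvd_of_coprime (fun i _ j _ hij => ?_) fun j hj => ?_
    · exact pairwise_coprime_X_sub_C (Nat.cast_injective (R := ℂ)) hij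
    · exact dvd_iff_isRoot.mpr (h0 j (Finset.mem_range.mp hj))
  obtain ⟨Q, rfl⟩ := hdvd
  have heval : ∀ z : ℂ, ‖(∏ j ∈ Finset.range N, (X - C (j : ℂ))).eval z‖
      = ∏ j ∈ Finset.range N, ‖z - j‖ := fun z => by
    rw [eval_prod, norm_prod]; simp
  have hsphere : ∀ z : ℂ, ‖z‖ = 5 * N → ‖Q.eval z‖ ≤ T / (4 * N) ^ N := fun z hz => by
    have h1 := hT z hz
    rw [eval_mul, norm_mul, heval] at h1
    have h2 : (4 * N : ℝ) ^ N ≤ ∏ j ∈ Finset.range N, ‖z - j‖ := by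
      rw [← Finset.card_range N, ← Finset.prod_const, Finset.card_range]
      refine Finset.prod_le_prod (fun _ _ => by positivity) fun j hj => ?_
      have hj' : (j : ℝ) ≤ N := by exact_mod_cast (Finset.mem_range.mp hj).le
      have := norm_sub_norm_le z (j : ℂ)
      rw [hz, Complex.norm_natCast] at this
      linarith
    rw [le_div_iff₀ (by positivity), mul_comm]
    exact (mul_le_mul_of_nonneg_right h2 (norm_nonneg _)).trans h1
  have hQ : ‖Q.eval (x : ℂ)‖ ≤ T / (4 * N) ^ N := by
    refine Complex.norm_le_of_forall_mem_frontier_norm_le (U := Metric.ball 0 (5 * N))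
      Metric.isBounded_ball (f := fun z => Q.eval z) Q.differentiable.diffContOnCl
      (fun v hv => ?_) ?_
    · rw [frontier_ball _ (by positivity), mem_sphere_zero_iff_norm] at hv
      exact hsphere v hv
    · rw [closure_ball _ (by positivity), mem_closedBall_zero_iff, Complex.norm_real,
        Real.norm_of_nonneg hx.1]
      linarith [hx.2]
  have hW : ∏ j ∈ Finset.range N, ‖(x : ℂ) - j‖ ≤ (N : ℝ) ^ N := by
    rw [← Finset.card_range N, ← Finset.prod_const, Finset.card_range]
    refine Finset.prod_le_prod (fun _ _ => norm_nonneg _) fun j hj => ?_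
    have hj' : (j : ℝ) ≤ N := by exact_mod_cast (Finset.mem_range.mp hj).le
    have : (x : ℂ) - j = ((x - j : ℝ) : ℂ) := by push_cast; ring
    rw [this, Complex.norm_real, Real.norm_eq_abs, abs_le]
    constructor <;> linarith [hx.1, hx.2, Nat.cast_nonneg (α := ℝ) j]
  rw [eval_mul, norm_mul, heval]
  calc (∏ j ∈ Finset.range N, ‖(x : ℂ) - j‖) * ‖Q.eval (x : ℂ)‖
      ≤ (N : ℝ) ^ N * (T / (4 * N) ^ N) := by gcongr
    _ = T / 4 ^ N := by rw [mul_pow]; field_simp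

/-- For degrees up to `C√n` the Bernstein-Walsh exponent does not depend on `n`. -/
lemma two_mul_mul_sqrt_div_le {C d n ρ : ℝ} (hn : 0 < n) (hd : d ≤ C * √n) :
    2 * d * √(ρ / n) ≤ 2 * C * √ρ := by
  rw [Real.sqrt_div' _ hn.le]
  have h : 0 < √n := Real.sqrt_pos.mpr hn
  calc 2 * d * (√ρ / √n) ≤ 2 * (C * √n) * (√ρ / √n) := by gcongr
    _ = 2 * C * √ρ := by field_simp

lemma exists_nat_mem_Icc_abs_sub_le {a b : ℕ} {x : ℝ} (hx : x ∈ Set.Icc (a : ℝ) b) :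
    ∃ k : ℕ, a ≤ k ∧ k ≤ b ∧ |x - k| ≤ 1 / 2 := by
  have ha : (0 : ℝ) ≤ a := Nat.cast_nonneg _
  refine ⟨⌊x + 1 / 2⌋₊, ?_, ?_, ?_⟩
  · exact Nat.le_floor (by linarith [hx.1])
  · have h := Nat.floor_le (a := x + 1 / 2) (by linarith [hx.1])
    have : ((⌊x + 1 / 2⌋₊ : ℕ) : ℝ) < (b + 1 : ℕ) := by push_cast; linarith [hx.2]
    exact Nat.lt_succ_iff.mp (by exact_mod_cast this)
  · have h := Nat.floor_le (a := x + 1 / 2) (by linarith [hx.1])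
    have h' := Nat.lt_floor_add_one (x + 1 / 2)
    rw [abs_le]; constructor <;> linarith

/-- The scale `N` depends on `C` only. The first inequality makes the derivative at most half the
maximum on `[N, n - N]`; the second lets the Schwarz factor `4 ^ N` beat the growth on the disc of
radius `5N`. -/
lemma exists_scale (C : ℝ) : ∃ N : ℕ, 4 ≤ N ∧ 2 * Real.exp (2 * C) ≤ √N ∧
    Real.exp (2 * C * √(5 * N)) ≤ 4 ^ N / 4 := by
  obtain ⟨N, hN⟩ := exists_nat_ge (max 4 (max ((2 * Real.exp (2 * C)) ^ 2) ((10 * C) ^ 2)))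
  have h4 : (4 : ℝ) ≤ N := (le_max_left _ _).trans hN
  have h1 : (2 * Real.exp (2 * C)) ^ 2 ≤ N := (le_max_left _ _).trans ((le_max_right _ _).trans hN)
  have h2 : (10 * C) ^ 2 ≤ N := (le_max_right _ _).trans ((le_max_right _ _).trans hN)
  refine ⟨N, by exact_mod_cast h4, Real.le_sqrt_of_sq_le h1, ?_⟩
  have h3 : 10 * C ≤ √N := Real.le_sqrt_of_sq_le h2
  have hs : √N * √N = N := Real.mul_self_sqrt (by positivity)
  have h5 : √(5 * N) ≤ 9 / 4 * √N := by
    rw [Real.sqrt_mul (by norm_num)]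
    gcongr
    rw [Real.sqrt_le_left (by norm_num)]; norm_num
  have hlin : 2 * C * √(5 * N) ≤ N - 1 := by
    rcases le_total C 0 with hC | hC
    · have : 2 * C * √(5 * N) ≤ 0 :=
        mul_nonpos_of_nonpos_of_nonneg (by linarith) (Real.sqrt_nonneg _)
      linarith
    · calc 2 * C * √(5 * N) ≤ 2 * C * (9 / 4 * √N) := by gcongr
        _ = 9 / 20 * (10 * C * √N) := by ring
        _ ≤ 9 / 20 * (√N * √N) := by gcongr
        _ ≤ N - 1 := by rw [hs]; linarith
  have he : Real.exp 1 ≤ 4 := by linarith [Real.exp_one_lt_d9]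
  calc Real.exp (2 * C * √(5 * N)) ≤ Real.exp (N - 1) := Real.exp_le_exp.mpr hlin
    _ = Real.exp 1 ^ N / Real.exp 1 := by
        rw [Real.exp_sub, ← Real.exp_nat_mul, mul_one]
    _ ≤ 4 ^ N / 4 := by
        obtain ⟨M, rfl⟩ : ∃ M, N = M + 1 := ⟨N - 1, by
          have : 4 ≤ N := by exact_mod_cast h4
          omega⟩
        rw [pow_succ, pow_succ, mul_div_cancel_right₀ _ (Real.exp_pos 1).ne',
          mul_div_cancel_right₀ _ (by norm_num)]
        gcongr

/-- Subtract the interpolant of `P` at `0, …, N - 1` and apply the Schwarz lemma to the difference,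
which Bernstein-Walsh bounds on the circle of radius `5N`. The point is the factor `1 / 4` in front
of `S`: it allows absorption when `S` is the maximum of `|P|`. -/
lemma norm_eval_le_of_left {C Λ S B : ℝ} {N n : ℕ} (hN : 4 ≤ N)
    (hexp : Real.exp (2 * C * √(5 * N)) ≤ 4 ^ N / 4) (hB : 0 ≤ B) (hΛ : 1 ≤ Λ)
    (hI : ∀ (y : ℕ → ℂ) (B : ℝ), 0 ≤ B → (∀ j < N, ‖y j‖ ≤ B) → ∃ I : ℂ[X],
      (∀ j < N, I.eval (j : ℂ) = y j) ∧ ∀ z : ℂ, ‖z‖ ≤ 5 * N → ‖I.eval z‖ ≤ Λ * B)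
    (hn : 2 * N ≤ n) {P : ℂ[X]} (hd : P.natDegree ≤ C * √n)
    (hS : ∀ x ∈ Set.Icc (0 : ℝ) n, ‖P.eval (x : ℂ)‖ ≤ S)
    (hP : ∀ k ≤ n, ‖P.eval (k : ℂ)‖ ≤ B) {x : ℝ} (hx : x ∈ Set.Icc (0 : ℝ) N) :
    ‖P.eval (x : ℂ)‖ ≤ 2 * Λ * B + S / 4 := by
  have hn0 : (0 : ℝ) < n := by exact_mod_cast (by omega : 0 < n)
  have hS0 : 0 ≤ S := (norm_nonneg _).trans (hS 0 ⟨le_rfl, hn0.le⟩)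
  obtain ⟨I, hI1, hI2⟩ := hI (fun j => P.eval (j : ℂ)) B hB fun j hj => hP j (by omega)
  have hE := norm_eval_le_of_vanishing (E := P - I) (N := N) (by omega)
    (T := S * (4 ^ N / 4) + Λ * B)
    (fun j hj => by rw [eval_sub, hI1 j hj, sub_self]) (fun z hz => by
      rw [eval_sub]
      refine (norm_sub_le _ _).trans (add_le_add ?_ (hI2 z hz.le))
      refine (norm_eval_le_of_dist_le le_rfl hn0 hS (x := 0) ⟨le_rfl, hn0.le⟩
        (ρ := 5 * N) (by simp [hz])).trans ?_
      gcongr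
      exact (Real.exp_le_exp.mpr (two_mul_mul_sqrt_div_le hn0 hd)).trans hexp) hx
  have h4 : (1 : ℝ) ≤ 4 ^ N := one_le_pow₀ (by norm_num)
  have h5 : (S * (4 ^ N / 4) + Λ * B) / 4 ^ N ≤ S / 4 + Λ * B := by
    rw [div_le_iff₀ (by positivity)]
    have : 0 ≤ Λ * B := by positivity
    nlinarith
  have hx' : ‖(x : ℂ)‖ ≤ 5 * N := by
    rw [Complex.norm_real, Real.norm_of_nonneg hx.1]
    linarith [hx.2, Nat.cast_nonneg (α := ℝ) N]
  calc ‖P.eval (x : ℂ)‖ = ‖(P - I).eval (x : ℂ) + I.eval (x : ℂ)‖ := by rw [eval_sub]; ring_nf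
    _ ≤ _ := norm_add_le _ _
    _ ≤ _ := by linarith [hI2 x hx']

/-- A polynomial of degree `O(√n)` that is bounded at the integers `0, …, n` is bounded on
`[0, n]`. -/
theorem exists_norm_eval_le_of_integer_points (C : ℝ) : ∃ (A : ℝ) (N₀ : ℕ), 1 ≤ A ∧
    ∀ n : ℕ, N₀ ≤ n → ∀ (P : ℂ[X]) (B : ℝ), P.natDegree ≤ C * √n →
      (∀ k ≤ n, ‖P.eval (k : ℂ)‖ ≤ B) → ∀ x ∈ Set.Icc (0 : ℝ) n, ‖P.eval (x : ℂ)‖ ≤ A * B := by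
  obtain ⟨N, hN4, hN, hexp⟩ := exists_scale C
  obtain ⟨Λ, hΛ, hI⟩ := exists_interpolation_bound N (5 * N)
  refine ⟨4 * Λ, 2 * N, by linarith, fun n hn P B hd hP => ?_⟩
  have hB : 0 ≤ B := (norm_nonneg _).trans (hP 0 (Nat.zero_le _))
  have hn0 : (0 : ℝ) < n := by exact_mod_cast (by omega : 0 < n)
  obtain ⟨s, hs, hmax⟩ := isCompact_Icc.exists_isMaxOn (Set.nonempty_Icc.mpr hn0.le)
    (f := fun x : ℝ => ‖P.eval (x : ℂ)‖)
    ((P.continuous.comp Complex.continuous_ofReal).norm.continuousOn)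
  have hS : ∀ x ∈ Set.Icc (0 : ℝ) n, ‖P.eval (x : ℂ)‖ ≤ ‖P.eval (s : ℂ)‖ := fun x hx => hmax hx
  set S := ‖P.eval (s : ℂ)‖ with hSdef
  have hΛB : B ≤ Λ * B := le_mul_of_one_le_left hB hΛ
  -- Any bound of this shape absorbs `S / 4` into the left side; the cases are the position `s` of
  -- the maximum: near `0`, near `n`, or in between.
  suffices h : S ≤ 2 * Λ * B + S / 4 by
    intro x hx
    have := hS x hx
    nlinarith
  rcases le_total s N with h1 | h1
  · exact norm_eval_le_of_left hN4 hexp hB hΛ hI hn hd hS hP ⟨hs.1, h1⟩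
  rcases le_total ((n : ℝ) - N) s with h2 | h2
  -- The right end follows from the left one by the reflection `x ↦ n - x`, which preserves the
  -- integer points.
  · have hcomp : ∀ z : ℂ, (P.comp (Polynomial.C (n : ℂ) - X)).eval z = P.eval (n - z) := by
      intro z; simp
    have := norm_eval_le_of_left (P := P.comp (Polynomial.C (n : ℂ) - X)) (S := S) hN4 hexp hB hΛ
      hI hn ?_ ?_ ?_ (x := n - s) ⟨by linarith [hs.2], by linarith⟩
    · rw [hcomp] at this
      push_cast at this
      rwa [sub_sub_cancel] at this
    · refine le_trans ?_ hd
      rw [natDegree_comp]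
      have : (Polynomial.C (n : ℂ) - X).natDegree ≤ 1 :=
        (natDegree_sub_le _ _).trans (by simp)
      exact_mod_cast (Nat.mul_le_mul_left _ this).trans (mul_one _).le
    · intro x hx
      rw [hcomp]
      have := hS (n - x) ⟨by linarith [hx.2], by linarith [hx.1]⟩
      push_cast at this
      exact this
    · intro k hk
      rw [hcomp, ← Nat.cast_sub hk]
      exact hP _ (Nat.sub_le _ _)
  · have hcast : ((n - N : ℕ) : ℝ) = n - N := Nat.cast_sub (by omega)
    obtain ⟨k, hk1, hk2, hk⟩ := exists_nat_mem_Icc_abs_sub_le (a := N) (b := n - N) (x := s)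
      ⟨h1, by rw [hcast]; exact h2⟩
    have hN4' : (4 : ℝ) ≤ N := by exact_mod_cast hN4
    have hsN : 0 < √(N : ℝ) := Real.sqrt_pos.mpr (by linarith)
    -- With slope at most `S / 2` and an integer within distance `1 / 2` of `s`, the maximum is at
    -- most `B + S / 4`.
    have hder : ∀ x ∈ Set.Icc (N : ℝ) (n - N), ‖P.derivative.eval (x : ℂ)‖ ≤ S / 2 := by
      intro x hx
      refine (norm_eval_derivative_le_middle le_rfl hS hN4' hx).trans ?_
      have h := two_mul_mul_sqrt_div_le (ρ := 1) hn0 hd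
      rw [Real.sqrt_one, mul_one] at h
      rw [div_le_iff₀ hsN]
      calc S * Real.exp _ ≤ S * Real.exp (2 * C) := by
            have := Real.exp_le_exp.mpr h
            gcongr
        _ ≤ S * (√N / 2) := by
            gcongr; linarith
        _ = S / 2 * √N := by ring
    have hk' : (k : ℝ) ∈ Set.Icc (N : ℝ) (n - N) := by
      refine ⟨by exact_mod_cast hk1, ?_⟩
      rw [← hcast]; exact_mod_cast hk2
    have hsub := norm_eval_sub_le_of_derivative hder (x := s) (y := k) ⟨h1, h2⟩ hk'
    have hPk := hP k (by omega)
    have htri : S ≤ ‖P.eval (s : ℂ) - P.eval ((k : ℝ) : ℂ)‖ + ‖P.eval ((k : ℝ) : ℂ)‖ := by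
      rw [hSdef]
      simpa using norm_add_le (P.eval (s : ℂ) - P.eval ((k : ℝ) : ℂ)) (P.eval ((k : ℝ) : ℂ))
    have : S / 2 * |s - k| ≤ S / 2 * (1 / 2) := by
      gcongr
    have hPk' : ‖P.eval ((k : ℝ) : ℂ)‖ ≤ B := by simpa using hPk
    nlinarith

end IntegerPoints

/-! ### The discrete Chebyshev problem -/

section MinDev

open Polynomial

/-- Evaluation of polynomials at the points `1, …, n`. -/
noncomputable def evalPoints (n : ℕ) : ℝ[X] →ₗ[ℝ] (Fin n → ℝ) :=
  LinearMap.pi fun k => Polynomial.leval ((k : ℕ) + 1 : ℝ)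

/-- The values at `1, …, n` of the polynomials of degree at most `d` that vanish at `0`. -/
noncomputable def devSpace (n d : ℕ) : Submodule ℝ (Fin n → ℝ) :=
  (degreeLT ℝ (d + 1) ⊓ LinearMap.ker (Polynomial.leval (0 : ℝ))).map (evalPoints n)

/-- The least maximal modulus on `1, …, n` of a polynomial of degree at most `d` with value `1`
at `0`. -/
noncomputable def minDev (n d : ℕ) : ℝ := Metric.infDist (1 : Fin n → ℝ) (devSpace n d)

lemma minDev_nonneg (n d : ℕ) : 0 ≤ minDev n d := Metric.infDist_nonneg

lemma natDegree_le_iff_mem_degreeLT {p : ℝ[X]} {d : ℕ} :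
    p ∈ degreeLT ℝ (d + 1) ↔ p.natDegree ≤ d := by
  rw [degreeLT_succ_eq_degreeLE, mem_degreeLE, natDegree_le_iff_degree_le]

lemma mem_devSpace {n d : ℕ} {v : Fin n → ℝ} : v ∈ devSpace n d ↔
    ∃ q : ℝ[X], q.natDegree ≤ d ∧ q.eval 0 = 0 ∧ ∀ k : Fin n, v k = q.eval ((k : ℕ) + 1 : ℝ) := by
  simp only [devSpace, Submodule.mem_map, Submodule.mem_inf, natDegree_le_iff_mem_degreeLT,
    LinearMap.mem_ker, leval_apply, and_assoc]
  refine exists_congr fun q => and_congr_right fun _ => and_congr_right fun _ => ?_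
  rw [eq_comm, funext_iff]
  rfl

lemma minDev_le {n d : ℕ} {p : ℝ[X]} (hd : p.natDegree ≤ d) (h0 : p.eval 0 = 1) {B : ℝ}
    (hB : 0 ≤ B) (h : ∀ k : ℕ, 1 ≤ k → k ≤ n → |p.eval (k : ℝ)| ≤ B) : minDev n d ≤ B := by
  have hmem : (fun k : Fin n => (1 - p).eval ((k : ℕ) + 1 : ℝ)) ∈ devSpace n d :=
    mem_devSpace.mpr ⟨1 - p, (natDegree_sub_le _ _).trans (by simpa using hd), by simp [h0],
      fun _ => rfl⟩
  refine (Metric.infDist_le_dist_of_mem hmem).trans ?_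
  rw [dist_pi_le_iff hB]
  intro k
  have := h (k + 1) (by omega) (by omega)
  push_cast at this
  simpa [Real.dist_eq] using this

lemma exists_minDev (n d : ℕ) : ∃ p : ℝ[X], p.natDegree ≤ d ∧ p.eval 0 = 1 ∧
    ∀ k : ℕ, 1 ≤ k → k ≤ n → |p.eval (k : ℝ)| ≤ minDev n d := by
  obtain ⟨v, hv, hdist⟩ := (Submodule.closed_of_finiteDimensional
    (devSpace n d)).exists_infDist_eq_dist ⟨0, (devSpace n d).zero_mem⟩ (1 : Fin n → ℝ)
  obtain ⟨q, hq, hq0, hqv⟩ := mem_devSpace.mp hv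
  refine ⟨1 - q, (natDegree_sub_le _ _).trans (by simpa using hq), by simp [hq0],
    fun k hk1 hkn => ?_⟩
  rw [minDev, hdist]
  have := dist_le_pi_dist (1 : Fin n → ℝ) v ⟨k - 1, by omega⟩
  rw [hqv, Real.dist_eq] at this
  simpa [Nat.cast_sub hk1] using this

lemma minDev_le_one (n d : ℕ) : minDev n d ≤ 1 :=
  minDev_le (p := 1) (by simp) (by simp) zero_le_one (by simp)

lemma mul_sinh_le_sinh_mul (d : ℕ) {x : ℝ} (hx : 0 ≤ x) : d * Real.sinh x ≤ Real.sinh (d * x) := by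
  induction d with
  | zero => simp
  | succ d ih =>
    have h1 := Real.one_le_cosh x
    have h2 := Real.one_le_cosh (d * x)
    have h3 := Real.sinh_nonneg_iff.mpr hx
    have h4 : 0 ≤ Real.sinh (d * x) := Real.sinh_nonneg_iff.mpr (by positivity)
    rw [Nat.cast_succ, add_mul, one_mul, add_mul, one_mul, Real.sinh_add]
    nlinarith

lemma cosh_eq_one_add_two_mul_sinh_sq (x : ℝ) :
    Real.cosh x = 1 + 2 * Real.sinh (x / 2) ^ 2 := by
  have h2 : Real.cosh x = Real.cosh (x / 2) ^ 2 + Real.sinh (x / 2) ^ 2 := by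
    rw [← Real.cosh_two_mul]; congr 1; ring
  have := Real.cosh_sq (x / 2)
  linarith

/-- With `u = cosh s`, `T_d(u) - 1 = 2 sinh²(ds/2) ≥ 2 d² sinh²(s/2) = d² (u - 1)`. -/
lemma one_add_sq_mul_le_eval_T (d : ℕ) {u : ℝ} (hu : 1 ≤ u) :
    1 + d ^ 2 * (u - 1) ≤ (Chebyshev.T ℝ d).eval u := by
  obtain ⟨s, hs, rfl⟩ : ∃ s, 0 ≤ s ∧ Real.cosh s = u :=
    ⟨_, Real.arcosh_nonneg hu, Real.cosh_arcosh hu⟩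
  rw [Chebyshev.T_real_cosh, Int.cast_natCast, cosh_eq_one_add_two_mul_sinh_sq (d * s),
    cosh_eq_one_add_two_mul_sinh_sq s, mul_div_assoc]
  have h := mul_sinh_le_sinh_mul d (x := s / 2) (by positivity)
  have h3 : 0 ≤ d * Real.sinh (s / 2) :=
    mul_nonneg (Nat.cast_nonneg _) (Real.sinh_nonneg_iff.mpr (by positivity))
  nlinarith

lemma natDegree_T_comp_le (d : ℕ) (a b : ℝ) :
    ((Chebyshev.T ℝ d).comp (C a - C b * X)).natDegree ≤ d := by
  rw [natDegree_comp, Chebyshev.natDegree_T, Int.natAbs_natCast]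
  have : (C a - C b * X : ℝ[X]).natDegree ≤ 1 := by compute_degree
  exact (Nat.mul_le_mul_left _ this).trans (mul_one _).le

/-- The competitor is the Chebyshev polynomial transplanted to `[1, n]` and normalized at `0`, which
the affine map sends to `(n + 1) / (n - 1)`. -/
lemma minDev_le_inv_eval_T {n : ℕ} (hn : 2 ≤ n) (d : ℕ) :
    minDev n d ≤ ((Chebyshev.T ℝ d).eval ((n + 1) / (n - 1) : ℝ))⁻¹ := by
  have hn' : (2 : ℝ) ≤ n := by exact_mod_cast hn
  have h1 : (0 : ℝ) < n - 1 := by linarith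
  have hu : (1 : ℝ) ≤ (n + 1) / (n - 1) := by rw [le_div_iff₀ h1]; linarith
  set u : ℝ := (n + 1) / (n - 1)
  have hT := Chebyshev.one_le_eval_T_real d hu
  have hT0 : (Chebyshev.T ℝ d).eval u ≠ 0 := by positivity
  refine minDev_le (p := C ((Chebyshev.T ℝ d).eval u)⁻¹ *
    (Chebyshev.T ℝ d).comp (C u - C (2 / (n - 1) : ℝ) * X))
    ((natDegree_C_mul_le _ _).trans (natDegree_T_comp_le _ _ _)) ?_ (by positivity) ?_
  · simp [hT0]
  · intro k hk1 hkn
    have hk1' : (1 : ℝ) ≤ k := by exact_mod_cast hk1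
    have hkn' : (k : ℝ) ≤ n := by exact_mod_cast hkn
    have : |u - 2 / (n - 1) * k| ≤ 1 := by
      have e : u - 2 / (n - 1) * k = (n + 1 - 2 * k) / (n - 1) := by
        simp only [u]; field_simp
      rw [e, abs_le, le_div_iff₀ h1, div_le_iff₀ h1]
      constructor <;> linarith
    have h2 := Chebyshev.abs_eval_T_real_le_one d this
    simp only [eval_mul, eval_C, eval_comp, eval_sub, eval_X, abs_mul]
    rw [abs_of_nonneg (by positivity : 0 ≤ ((Chebyshev.T ℝ d).eval u)⁻¹)]
    exact mul_le_of_le_one_right (by positivity) h2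

lemma minDev_le_inv {n : ℕ} (hn : 2 ≤ n) (d : ℕ) :
    minDev n d ≤ (1 + 2 * ((d : ℝ) ^ 2 / n))⁻¹ := by
  have hn' : (2 : ℝ) ≤ n := by exact_mod_cast hn
  have h1 : (0 : ℝ) < n - 1 := by linarith
  refine (minDev_le_inv_eval_T hn d).trans (inv_anti₀ (by positivity) ?_)
  refine le_trans ?_ (one_add_sq_mul_le_eval_T d (by rw [le_div_iff₀ h1]; linarith))
  have : (n + 1) / (n - 1) - 1 = 2 / (n - 1 : ℝ) := by field_simp; ring
  rw [this]
  have h2 : (2 : ℝ) / n ≤ 2 / (n - 1) := by gcongr; linarith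
  calc 1 + 2 * ((d : ℝ) ^ 2 / n) = 1 + d ^ 2 * (2 / n) := by ring
    _ ≤ _ := by gcongr

lemma two_mul_le_log_sub_log {t : ℝ} (h0 : 0 ≤ t) (h1 : t < 1) :
    2 * t ≤ Real.log (1 + t) - Real.log (1 - t) := by
  have h := Real.hasSum_log_sub_log_of_abs_lt_one (x := t) (by rwa [abs_of_nonneg h0])
  have := le_hasSum h 0 fun j _ => by positivity
  simpa using this

/-- With `t = 1/√n`, `(n + 1) / (n - 1)` is the hyperbolic cosine of `log ((1 + t) / (1 - t)) ≥ 2t`;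
then `cosh y ≥ exp y / 2`. -/
lemma minDev_le_exp {n : ℕ} (hn : 2 ≤ n) (d : ℕ) :
    minDev n d ≤ 2 * Real.exp (-2 * d / √n) := by
  have hn' : (2 : ℝ) ≤ n := by exact_mod_cast hn
  have hs : 1 < √(n : ℝ) := Real.lt_sqrt_of_sq_lt (by linarith)
  have hsq : √(n : ℝ) ^ 2 = n := Real.sq_sqrt (by linarith)
  set t : ℝ := (√(n : ℝ))⁻¹ with ht
  have ht0 : 0 < t := by positivity
  have ht1 : t < 1 := inv_lt_one_of_one_lt₀ hs
  have hb : 0 < (1 + t) / (1 - t) := div_pos (by linarith) (by linarith)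
  have hu : (n + 1) / (n - 1 : ℝ) = Real.cosh (Real.log ((1 + t) / (1 - t))) := by
    rw [Real.cosh_log hb, ← hsq, ht]
    have h1 : √(n : ℝ) - 1 ≠ 0 := by linarith
    have h2 : √(n : ℝ) + 1 ≠ 0 := by linarith
    have h3 : √(n : ℝ) ^ 2 - 1 ≠ 0 := by nlinarith
    have h4 : 1 - (√(n : ℝ))⁻¹ ≠ 0 := by rw [← ht]; linarith
    have h5 : 1 + (√(n : ℝ))⁻¹ ≠ 0 := by rw [← ht]; linarith
    have h0 : √(n : ℝ) ≠ 0 := by linarith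
    have e : (1 + (√(n : ℝ))⁻¹) / (1 - (√(n : ℝ))⁻¹) = (√(n : ℝ) + 1) / (√(n : ℝ) - 1) := by
      rw [div_eq_div_iff h4 h1]; field_simp
    rw [e]
    field_simp
    ring
  refine (minDev_le_inv_eval_T hn d).trans ?_
  rw [hu, Chebyshev.T_real_cosh, Int.cast_natCast]
  have hlog : 2 * t ≤ Real.log ((1 + t) / (1 - t)) := by
    rw [Real.log_div (by linarith) (by linarith)]
    exact two_mul_le_log_sub_log ht0.le ht1
  have hcosh : Real.exp (2 * d / √n) / 2 ≤ Real.cosh (d * Real.log ((1 + t) / (1 - t))) := by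
    rw [Real.cosh_eq]
    have : Real.exp (2 * d / √n) ≤ Real.exp (d * Real.log ((1 + t) / (1 - t))) := by
      rw [Real.exp_le_exp]
      calc 2 * d / √n = d * (2 * t) := by rw [ht]; ring
        _ ≤ _ := by gcongr
    linarith [Real.exp_pos (-(d * Real.log ((1 + t) / (1 - t))))]
  refine (inv_anti₀ (by positivity) hcosh).trans (le_of_eq ?_)
  rw [inv_div, neg_mul, neg_div, Real.exp_neg]
  ring

/-! #### Lower bounds -/

/-- The complexification of a real polynomial. -/
noncomputable abbrev complexify (p : ℝ[X]) : ℂ[X] := p.map (algebraMap ℝ ℂ)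

lemma norm_eval_complexify (p : ℝ[X]) (x : ℝ) : ‖(complexify p).eval (x : ℂ)‖ = |p.eval x| := by
  rw [← Complex.coe_algebraMap, eval_map_algebraMap, aeval_algebraMap_apply, Complex.coe_algebraMap,
    Complex.norm_real, Real.norm_eq_abs]
  simp

lemma norm_eval_complexify_natCast (p : ℝ[X]) (k : ℕ) :
    ‖(complexify p).eval (k : ℂ)‖ = |p.eval (k : ℝ)| := by
  simpa using norm_eval_complexify p k

lemma natDegree_complexify (p : ℝ[X]) : (complexify p).natDegree = p.natDegree :=
  natDegree_map _

lemma ofReal_eval_complexify (p : ℝ[X]) (x : ℝ) :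
    (complexify p).eval (x : ℂ) = ((p.eval x : ℝ) : ℂ) := by
  rw [← Complex.coe_algebraMap, eval_map_algebraMap, aeval_algebraMap_apply]
  simp

lemma abs_eval_sub_eq (p : ℝ[X]) (x y : ℝ) : |p.eval x - p.eval y| =
    ‖(complexify p).eval (x : ℂ) - (complexify p).eval (y : ℂ)‖ := by
  rw [ofReal_eval_complexify, ofReal_eval_complexify, ← Complex.ofReal_sub, Complex.norm_real,
    Real.norm_eq_abs]

lemma abs_eval_natCast_le_one {n d : ℕ} {p : ℝ[X]} (h0 : p.eval 0 = 1)
    (hp : ∀ k : ℕ, 1 ≤ k → k ≤ n → |p.eval (k : ℝ)| ≤ minDev n d) {k : ℕ} (hk : k ≤ n) :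
    |p.eval (k : ℝ)| ≤ 1 := by
  rcases Nat.eq_zero_or_pos k with rfl | hk0
  · simp [h0]
  · exact (hp k hk0 hk).trans (minDev_le_one n d)

/-- An extremal polynomial is bounded by `A * minDev n d` on all of `[1, n]`, yet equals `1` at the
point `0`, at distance `1` from that interval; Bernstein-Walsh limits the growth between them to a
constant factor. -/
theorem exists_le_minDev (C : ℝ) : ∃ a : ℝ, 0 < a ∧ ∀ᶠ n : ℕ in atTop, ∀ d : ℕ,
    (d : ℝ) ≤ C * √n → a ≤ minDev n d := by
  obtain ⟨A, N₀, hA, h⟩ := exists_norm_eval_le_of_integer_points (2 * C)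
  refine ⟨(A * Real.exp (4 * C))⁻¹, by positivity, ?_⟩
  filter_upwards [eventually_ge_atTop (N₀ + 2)] with n hn d hd
  obtain ⟨p, hpd, hp0, hp⟩ := exists_minDev n d
  obtain ⟨m, rfl⟩ : ∃ m, n = m + 1 := ⟨n - 1, by omega⟩
  have hm : (0 : ℝ) < m := by exact_mod_cast (by omega : 0 < m)
  have hm1 : (1 : ℝ) ≤ m := by exact_mod_cast (by omega : 1 ≤ m)
  -- The shift moves the nodes `1, …, m + 1` to `0, …, m` and the normalization to `-1`; the
  -- constant `2 * C` absorbs `√(m + 1) ≤ 2√m`.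
  set P := (complexify p).comp (X + Polynomial.C 1) with hP
  have hPe : ∀ z : ℂ, P.eval z = (complexify p).eval (z + 1) := fun z => by simp [hP]
  have hPd' : P.natDegree = p.natDegree := by
    rw [hP, natDegree_comp, natDegree_X_add_C, mul_one, natDegree_complexify]
  have hC : 0 ≤ C := by
    by_contra hC
    have h2 : 0 < √((m + 1 : ℕ) : ℝ) := Real.sqrt_pos.mpr (by positivity)
    nlinarith [Nat.cast_nonneg (α := ℝ) d]
  have hsqrt : √((m + 1 : ℕ) : ℝ) ≤ 2 * √m := by
    rw [Real.sqrt_le_left (by positivity), mul_pow, Real.sq_sqrt hm.le]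
    push_cast; linarith
  have hPd : (P.natDegree : ℝ) ≤ 2 * C * √m := by
    rw [hPd']
    calc (p.natDegree : ℝ) ≤ d := by exact_mod_cast hpd
      _ ≤ C * (2 * √m) := hd.trans (by gcongr)
      _ = 2 * C * √m := by ring
  have hbound := h m (by omega) P (minDev (m + 1) d) hPd fun k hk => by
    rw [hPe]
    have := norm_eval_complexify_natCast p (k + 1)
    push_cast at this
    rw [this]
    have := hp (k + 1) (by omega) (by omega)
    push_cast at this
    exact this
  have h1 := norm_eval_le_of_dist_le le_rfl hm hbound (x := 0) ⟨le_rfl, hm.le⟩ (ρ := 1) (z := -1)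
    (by simp)
  have h2 := two_mul_mul_sqrt_div_le (ρ := 1) hm hPd
  have h3 : P.eval (-1) = 1 := by
    rw [hPe, neg_add_cancel, eval_zero_map, hp0, map_one]
  rw [h3, norm_one] at h1
  rw [Real.sqrt_one, mul_one] at h2
  rw [inv_le_iff_one_le_mul₀ (by positivity)]
  calc 1 ≤ _ := h1
    _ ≤ A * minDev (m + 1) d * Real.exp (4 * C) := by
        have := minDev_nonneg (m + 1) d
        have h4 := Real.exp_le_exp.mpr h2
        rw [← mul_assoc, show (2 : ℝ) * 2 = 4 by norm_num] at h4
        gcongr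
    _ = _ := by ring

/-- An extremal polynomial has to fall from `1` to at most `minDev n d` between `0` and `1`, while
its derivative is `O(d²/n)` by the Markov type inequality. -/
theorem exists_one_sub_minDev_le : ∃ (c : ℝ), ∀ᶠ n : ℕ in atTop, ∀ d : ℕ,
    (d : ℝ) ≤ √n → 1 - minDev n d ≤ c * ((d : ℝ) ^ 2 / n) := by
  obtain ⟨A, N₀, hA, h⟩ := exists_norm_eval_le_of_integer_points 1
  refine ⟨A * Real.exp 2, ?_⟩
  filter_upwards [eventually_ge_atTop (N₀ + 1)] with n hn d hd
  obtain ⟨p, hpd, hp0, hp⟩ := exists_minDev n d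
  have hn1 : (1 : ℝ) ≤ n := by exact_mod_cast (by omega : 1 ≤ n)
  have hn0 : (0 : ℝ) < n := by linarith
  have hM : 1 - minDev n d ≤ |p.eval 0 - p.eval 1| := by
    have := hp 1 le_rfl (by omega)
    rw [Nat.cast_one] at this
    rw [hp0]
    linarith [le_abs_self (1 - p.eval 1), le_abs_self (p.eval 1)]
  refine hM.trans ?_
  rcases Nat.eq_zero_or_pos d with rfl | hd0
  · rw [Nat.le_zero, natDegree_eq_zero] at hpd
    obtain ⟨a, rfl⟩ := hpd
    simp
  have hd1 : (1 : ℝ) ≤ d := by exact_mod_cast hd0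
  have hdeg : ((complexify p).natDegree : ℝ) ≤ d := by
    rw [natDegree_complexify]; exact_mod_cast hpd
  have hbound := h n (by omega) (complexify p) 1 (by rw [one_mul]; exact hdeg.trans hd)
    fun k hk => by
      rw [norm_eval_complexify_natCast]; exact abs_eval_natCast_le_one hp0 hp hk
  rw [mul_one] at hbound
  -- The radius `n / d²` makes the exponent `2 d √(ρ/n)` equal to `2`.
  have hρ : (0 : ℝ) < n / d ^ 2 := by positivity
  have hder : ∀ x ∈ Set.Icc (0 : ℝ) n, ‖(complexify p).derivative.eval (x : ℂ)‖ ≤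
      A * Real.exp 2 * (d ^ 2 / n) := by
    intro x hx
    have h1 := norm_eval_derivative_le_edge (P := complexify p) (d := d)
      (by rw [natDegree_complexify]; exact hpd) hn0 hbound hρ hx
    have h2 : √((n : ℝ) / d ^ 2 / n) = 1 / d := by
      rw [div_right_comm, div_self hn0.ne', Real.sqrt_div zero_le_one, Real.sqrt_one,
        Real.sqrt_sq (by positivity)]
    have h3 : 2 * (d : ℝ) * (1 / d) = 2 := by field_simp
    rw [h2, h3] at h1
    refine h1.trans (le_of_eq ?_)
    rw [div_div_eq_mul_div, mul_div_assoc]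
  have h4 := norm_eval_sub_le_of_derivative hder (x := 0) (y := 1) ⟨le_rfl, hn0.le⟩
    ⟨zero_le_one, hn1⟩
  have h5 : (complexify p).eval ((0 : ℝ) : ℂ) - (complexify p).eval ((1 : ℝ) : ℂ)
      = ((p.eval 0 - p.eval 1 : ℝ) : ℂ) := by
    rw [ofReal_eval_complexify, ofReal_eval_complexify]; push_cast; ring
  rw [h5, Complex.norm_real, Real.norm_eq_abs] at h4
  simpa using h4

end MinDev

/-! ### Comparison of the discrete Chebyshev problem at different scales -/

section Comparison

open Polynomial

/-- Extremal polynomials of degree `O(√n)` are uniformly Lipschitz, and almost as small between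
the integers, away from the end points. -/
lemma exists_regular_extremal (C : ℝ) {ε : ℝ} (hε : 0 < ε) : ∃ (K N₀ : ℕ) (L : ℝ), 0 < L ∧ 0 < K ∧
    ∀ n : ℕ, N₀ ≤ n → ∀ d : ℕ, (d : ℝ) ≤ C * √n → ∃ p : ℝ[X], p.natDegree ≤ d ∧ p.eval 0 = 1 ∧
      (∀ k : ℕ, 1 ≤ k → k ≤ n → |p.eval (k : ℝ)| ≤ minDev n d) ∧
      (∀ x ∈ Set.Icc (K : ℝ) (n - K), |p.eval x| ≤ minDev n d + ε) ∧
      ∀ x ∈ Set.Icc (0 : ℝ) n, ∀ y ∈ Set.Icc (0 : ℝ) n, |p.eval x - p.eval y| ≤ L * |x - y| := by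
  obtain ⟨A, N₀, hA, h⟩ := exists_norm_eval_le_of_integer_points C
  set L : ℝ := A * Real.exp (2 * C) with hL
  have hL0 : 0 < L := by positivity
  -- The Bernstein type inequality bounds the derivative on `[K, n - K]` by `L / √K`, which this
  -- choice makes at most `ε`.
  obtain ⟨K, hK⟩ := exists_nat_ge (max 4 ((L / ε) ^ 2))
  have hK4 : (4 : ℝ) ≤ K := (le_max_left _ _).trans hK
  have hKL : L / ε ≤ √K := Real.le_sqrt_of_sq_le ((le_max_right _ _).trans hK)
  refine ⟨K, N₀ + 2 * K + 1, L, hL0, by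
    have : (0 : ℝ) < K := by linarith
    exact_mod_cast this, fun n hn d hd => ?_⟩
  obtain ⟨p, hpd, hp0, hp⟩ := exists_minDev n d
  have hn0 : (0 : ℝ) < n := by exact_mod_cast (by omega : 0 < n)
  have hdeg : ((complexify p).natDegree : ℝ) ≤ C * √n := by
    rw [natDegree_complexify]; exact le_trans (by exact_mod_cast hpd) hd
  have hbound := h n (by omega) (complexify p) 1 hdeg fun k hk => by
      rw [norm_eval_complexify_natCast]; exact abs_eval_natCast_le_one hp0 hp hk
  rw [mul_one] at hbound
  have hexp := two_mul_mul_sqrt_div_le (ρ := 1) hn0 hdeg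
  rw [Real.sqrt_one, mul_one] at hexp
  replace hexp := Real.exp_le_exp.mpr hexp
  refine ⟨p, hpd, hp0, hp, fun x hx => ?_, fun x hx y hy => ?_⟩
  · have hcast : ((n - K : ℕ) : ℝ) = n - K := Nat.cast_sub (by omega)
    obtain ⟨k, hk1, hk2, hk⟩ := exists_nat_mem_Icc_abs_sub_le (a := K) (b := n - K) (x := x)
      ⟨hx.1, by rw [hcast]; exact hx.2⟩
    have hk' : (k : ℝ) ∈ Set.Icc (K : ℝ) (n - K) :=
      ⟨by exact_mod_cast hk1, by rw [← hcast]; exact_mod_cast hk2⟩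
    have hder : ∀ y ∈ Set.Icc (K : ℝ) (n - K),
        ‖(complexify p).derivative.eval (y : ℂ)‖ ≤ ε := by
      intro y hy
      refine (norm_eval_derivative_le_middle le_rfl hbound hK4 hy).trans ?_
      have hK0 : 0 < √(K : ℝ) := Real.sqrt_pos.mpr (by linarith)
      rw [div_le_iff₀ hK0]
      calc A * Real.exp _ ≤ L := by rw [hL]; gcongr
        _ = ε * (L / ε) := by field_simp
        _ ≤ ε * √K := by gcongr
    have h1 := norm_eval_sub_le_of_derivative hder hx hk'
    rw [← abs_eval_sub_eq] at h1
    have h2 := hp k (by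
      have : (0 : ℝ) < K := by linarith
      have : 0 < K := by exact_mod_cast this
      omega) (by omega)
    have h3 : ε * |x - k| ≤ ε * 1 := by gcongr; linarith
    have h4 := abs_sub_abs_le_abs_sub (p.eval x) (p.eval (k : ℝ))
    linarith
  · rw [abs_eval_sub_eq]
    refine norm_eval_sub_le_of_derivative (a := 0) (b := n) (fun z hz => ?_) hx hy
    refine (norm_eval_derivative_le_edge le_rfl hn0 hbound one_pos hz).trans ?_
    rw [div_one, hL]
    gcongr

/-- With `u = cosh s`, `cosh (ks) ≤ exp (k²s²/2) ≤ exp (k²(u - 1))`, and `exp w ≤ 1 + w + w²` for `0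
≤ w ≤ 1`. With `one_add_sq_mul_le_eval_T` this makes `T_k` affine near `1` up to a quadratic error.
-/
lemma eval_T_le (k : ℕ) {u : ℝ} (hu : 1 ≤ u) (h : (k : ℝ) ^ 2 * (u - 1) ≤ 1) :
    (Chebyshev.T ℝ k).eval u ≤ 1 + k ^ 2 * (u - 1) + (k ^ 2 * (u - 1)) ^ 2 := by
  have h0 : 0 ≤ (k : ℝ) ^ 2 * (u - 1) := mul_nonneg (by positivity) (by linarith)
  have hexp := (abs_le.mp (Real.abs_exp_sub_one_sub_id_le
    (x := (k : ℝ) ^ 2 * (u - 1)) (by rwa [abs_of_nonneg h0]))).2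
  obtain ⟨s, hs, rfl⟩ : ∃ s, 0 ≤ s ∧ Real.cosh s = u :=
    ⟨_, Real.arcosh_nonneg hu, Real.cosh_arcosh hu⟩
  rw [Chebyshev.T_real_cosh, Int.cast_natCast]
  have h1 := Real.cosh_le_exp_half_sq (k * s)
  have h2 : Real.exp ((k * s) ^ 2 / 2) ≤ Real.exp (k ^ 2 * (Real.cosh s - 1)) := by
    rw [Real.exp_le_exp, mul_pow, mul_div_assoc]
    gcongr
    linarith [one_add_sq_div_two_le_cosh s]
  linarith

/-- A polynomial of degree `k` that is close to `x ↦ (1 - η) x` near `0` and maps `[x₀, m]` to an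
interval of length about `m / k ^ 2`. -/
lemma exists_rescaling {k : ℕ} {m η τ x₀ : ℝ} (hm : 0 < m) (hη0 : 0 ≤ η) (hη1 : η ≤ 1)
    (hτ : 0 < τ) (hτk : τ * m = k ^ 2) (hx₀ : 0 < x₀) (hsmall : 2 * τ * x₀ ≤ 1) :
    ∃ φ : ℝ[X], φ.natDegree ≤ k ∧ φ.eval 0 = 0 ∧
      (∀ x ∈ Set.Icc 0 x₀, |φ.eval x - (1 - η) * x| ≤ 2 * τ * x₀ ^ 2) ∧
      ∀ x ∈ Set.Icc x₀ m, (1 - η) * x₀ ≤ φ.eval x ∧ φ.eval x ≤ 2 * x₀ + (1 - η) / τ := by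
  -- The argument is `1` at `x₀`, so `T` oscillates within `[-1, 1]` on `[x₀, m]`, while on `[0,
  -- x₀]` it is nearly affine with slope `-2τ`. Hence `φ` is `T 0 - T` scaled by `(1 - η) / (2τ)`.
  set T : ℝ → ℝ := fun x => (Chebyshev.T ℝ k).eval (1 + 2 * x₀ / m - 2 / m * x) with hT
  have hlow : ∀ x ∈ Set.Icc 0 x₀, 2 * τ * (x₀ - x) ≤ T x - 1 ∧
      T x - 1 ≤ 2 * τ * (x₀ - x) + (2 * τ * x₀) ^ 2 := by
    intro x hx
    have hu : 1 ≤ 1 + 2 * x₀ / m - 2 / m * x := by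
      have : 0 ≤ 2 / m * (x₀ - x) := mul_nonneg (by positivity) (by linarith [hx.2])
      have e : 2 / m * (x₀ - x) = 2 * x₀ / m - 2 / m * x := by ring
      linarith
    have hw : (k : ℝ) ^ 2 * ((1 + 2 * x₀ / m - 2 / m * x) - 1) = 2 * τ * (x₀ - x) := by
      rw [← hτk]; field_simp; ring
    have hle : 2 * τ * (x₀ - x) ≤ 2 * τ * x₀ := by gcongr; linarith [hx.1]
    have h0 : 0 ≤ 2 * τ * (x₀ - x) := mul_nonneg (by positivity) (by linarith [hx.2])
    have h1 := one_add_sq_mul_le_eval_T k hu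
    have h2 := eval_T_le k hu (by rw [hw]; linarith)
    rw [hw] at h1 h2
    have h3 : (2 * τ * (x₀ - x)) ^ 2 ≤ (2 * τ * x₀) ^ 2 := by gcongr
    constructor <;> simp only [hT] <;> linarith
  have h00 := hlow 0 ⟨le_rfl, hx₀.le⟩
  rw [sub_zero] at h00
  have hB : 0 ≤ (1 - η) / (2 * τ) := div_nonneg (by linarith) (by positivity)
  have heval : ∀ x, (Polynomial.C ((1 - η) / (2 * τ)) * (Polynomial.C (T 0) - (Chebyshev.T ℝ k).comp
      (Polynomial.C (1 + 2 * x₀ / m) - Polynomial.C (2 / m) * X))).eval x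
        = (1 - η) / (2 * τ) * (T 0 - T x) := fun x => by
    simp [hT]
  refine ⟨Polynomial.C ((1 - η) / (2 * τ)) * (Polynomial.C (T 0) - (Chebyshev.T ℝ k).comp
      (Polynomial.C (1 + 2 * x₀ / m) - Polynomial.C (2 / m) * X)), ?_, ?_, ?_, ?_⟩
  · refine (natDegree_C_mul_le _ _).trans ((natDegree_sub_le _ _).trans ?_)
    rw [natDegree_C]
    exact max_le (Nat.zero_le _) (natDegree_T_comp_le _ _ _)
  · rw [heval, sub_self, mul_zero]
  · intro x hx
    rw [heval]
    have h := hlow x hx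
    have e : (1 - η) / (2 * τ) * (T 0 - T x) - (1 - η) * x =
        (1 - η) / (2 * τ) * (T 0 - T x - 2 * τ * x) := by field_simp
    rw [e, abs_mul, abs_of_nonneg hB]
    calc (1 - η) / (2 * τ) * |T 0 - T x - 2 * τ * x|
        ≤ (1 - η) / (2 * τ) * (2 * τ * x₀) ^ 2 := by
          gcongr
          rw [abs_le]
          constructor <;> nlinarith
      _ = (1 - η) * (2 * τ * x₀ ^ 2) := by field_simp
      _ ≤ 1 * (2 * τ * x₀ ^ 2) := by gcongr; linarith
      _ = _ := one_mul _
  · intro x hx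
    rw [heval]
    have hTx : |T x| ≤ 1 := by
      refine Chebyshev.abs_eval_T_real_le_one k ?_
      have e : 1 + 2 * x₀ / m - 2 / m * x = (m + 2 * (x₀ - x)) / m := by field_simp; ring
      rw [e, abs_le, le_div_iff₀ hm, div_le_iff₀ hm]
      constructor <;> linarith [hx.1, hx.2]
    rw [abs_le] at hTx
    have hsq : (2 * τ * x₀) ^ 2 ≤ 2 * τ * x₀ := by
      rw [sq]; exact mul_le_of_le_one_left (by positivity) hsmall
    constructor
    · calc (1 - η) * x₀ = (1 - η) / (2 * τ) * (2 * τ * x₀) := by field_simp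
        _ ≤ _ := by gcongr; linarith
    · calc (1 - η) / (2 * τ) * (T 0 - T x) ≤ (1 - η) / (2 * τ) * (4 * τ * x₀ + 2) := by
            gcongr; linarith
        _ = (1 - η) * (2 * x₀) + (1 - η) / τ := by field_simp; ring
        _ ≤ 1 * (2 * x₀) + (1 - η) / τ := by gcongr; linarith
        _ = _ := by rw [one_mul]

/-- The competitor is `p.comp φ`. Integers `j ≤ 2K` are moved so little that the Lipschitz bound
applies; all others land in `[K, n - K]`, where `p` is small between the integers too. -/
lemma minDev_le_of_rescaling {K n d m d' k : ℕ} {L ε η τ : ℝ} {p : ℝ[X]} (hpd : p.natDegree ≤ d)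
    (hp0 : p.eval 0 = 1) (hp : ∀ k : ℕ, 1 ≤ k → k ≤ n → |p.eval (k : ℝ)| ≤ minDev n d)
    (hpK : ∀ x ∈ Set.Icc (K : ℝ) (n - K), |p.eval x| ≤ minDev n d + ε)
    (hpL : ∀ x ∈ Set.Icc (0 : ℝ) n, ∀ y ∈ Set.Icc (0 : ℝ) n, |p.eval x - p.eval y| ≤ L * |x - y|)
    (hK : 0 < K) (hL : 0 ≤ L) (hε : 0 ≤ ε) (hm : 0 < m) (hη0 : 0 ≤ η) (hη : η ≤ 1 / 2) (hτ : 0 < τ)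
    (hτk : τ * m = k ^ 2) (hkd : k * d ≤ d') (hτK : 4 * K * τ ≤ 1) (hKn : 2 * K < n)
    (he1 : 2 * K * η + 8 * K ^ 2 * τ ≤ 1 / 2) (he2 : L * (2 * K * η + 8 * K ^ 2 * τ) ≤ ε)
    (hn : (1 - η) / τ ≤ n - 5 * K) : minDev m d' ≤ minDev n d + ε := by
  have hK0 : (0 : ℝ) < K := Nat.cast_pos.mpr hK
  obtain ⟨φ, hφd, hφ0, hφ1, hφ2⟩ := exists_rescaling (k := k) (m := m) (η := η) (τ := τ)
    (x₀ := 2 * K) (by exact_mod_cast hm) hη0 (by linarith) hτ hτk (by positivity) (by linarith)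
  refine minDev_le (p := p.comp φ) ?_ ?_ (add_nonneg (minDev_nonneg _ _) hε) ?_
  · rw [natDegree_comp]
    calc p.natDegree * φ.natDegree ≤ d * k := Nat.mul_le_mul hpd hφd
      _ = k * d := mul_comm _ _
      _ ≤ d' := hkd
  · rw [eval_comp, hφ0, hp0]
  · intro j hj1 hjm
    rw [eval_comp]
    have hj1' : (1 : ℝ) ≤ j := by exact_mod_cast hj1
    rcases le_total j (2 * K) with hj | hj
    · have hj' : (j : ℝ) ≤ 2 * K := by exact_mod_cast hj
      have hKn' : (2 * K + 1 : ℝ) ≤ n := by exact_mod_cast hKn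
      have h1 := hφ1 j ⟨by linarith, hj'⟩
      have h2 : |φ.eval (j : ℝ) - j| ≤ 2 * K * η + 8 * K ^ 2 * τ := by
        have e : φ.eval (j : ℝ) - j = (φ.eval (j : ℝ) - (1 - η) * j) + -(η * j) := by ring
        rw [e]
        refine (abs_add_le _ _).trans ?_
        rw [abs_neg, abs_of_nonneg (by positivity : 0 ≤ η * (j : ℝ))]
        have : η * (j : ℝ) ≤ η * (2 * K) := by gcongr
        nlinarith
      have h3 := abs_le.mp (h2.trans he1)
      have h4 := hpL (φ.eval (j : ℝ)) ⟨by linarith, by linarith⟩ j ⟨by linarith, by linarith⟩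
      have h5 := hp j hj1 (by omega)
      have h6 : L * |φ.eval (j : ℝ) - j| ≤ ε := (by gcongr : _ ≤ _).trans he2
      have h7 := abs_sub_abs_le_abs_sub (p.eval (φ.eval (j : ℝ))) (p.eval (j : ℝ))
      linarith
    · have h1 := hφ2 j ⟨by exact_mod_cast hj, by exact_mod_cast hjm⟩
      refine hpK _ ⟨?_, by linarith [h1.2]⟩
      nlinarith [h1.1]

/-- Here `X = √n`, `Y = √m` and `k` is the integer part of `d' / d`. As `d / X` and `d' / Y` are
both close to `c`, the ratio `k X / Y` is close to `1`; rounding costs only about `X / Y ≤ η / 32`.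
-/
lemma rescaling_ratio_bounds {c η X Y d d' k : ℝ} (hc : 0 < c) (hη0 : 0 < η) (hη2 : η ≤ 1 / 2)
    (hX : 0 < X) (hY : 0 < Y) (hXY : 32 / η * X ≤ Y) (hk : 0 ≤ k)
    (hd1 : d ≤ (c + c * η / 64) * X) (hd2 : (c - c * η / 64) * X ≤ d)
    (hd'1 : d' ≤ (c + c * η / 64) * Y) (hd'2 : (c - c * η / 64) * Y ≤ d')
    (hk1 : k * d ≤ d') (hk2 : d' ≤ (k + 1) * d) : 1 - η / 16 ≤ k * X / Y ∧ k * X / Y ≤ 2 := by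
  obtain ⟨s, hs⟩ : ∃ s : ℝ, s = k * X / Y := ⟨_, rfl⟩
  rw [← hs]
  have hkm : k * X = s * Y := by rw [hs]; field_simp
  have hcη : c * η / 64 ≤ c / 128 := by nlinarith
  constructor
  · have h1 : (c - c * η / 64) * Y ≤ (k + 1) * ((c + c * η / 64) * X) :=
      hd'2.trans (hk2.trans (by gcongr))
    have h2 : X ≤ η / 32 * Y := by
      have := hXY
      rw [div_mul_eq_mul_div, div_le_iff₀ hη0] at this
      linarith
    have h3 : (k + 1) * ((c + c * η / 64) * X) = (c + c * η / 64) * (s * Y + X) := by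
      rw [← hkm]; ring
    rw [h3] at h1
    have h4 : (c - c * η / 64) * Y ≤ (c + c * η / 64) * ((s + η / 32) * Y) := by
      refine h1.trans ?_
      gcongr
      linarith
    rw [← mul_assoc] at h4
    have h5 := le_of_mul_le_mul_right h4 hY
    have h6 : (c - c * η / 64) = c * (1 - η / 64) := by ring
    have h7 : (c + c * η / 64) * (s + η / 32) = c * ((1 + η / 64) * (s + η / 32)) := by ring
    rw [h6, h7] at h5
    have h8 := le_of_mul_le_mul_left h5 hc
    by_contra hcon
    push Not at hcon
    nlinarith
  · have h1 : k * ((c - c * η / 64) * X) ≤ (c + c * η / 64) * Y :=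
      (by gcongr : k * ((c - c * η / 64) * X) ≤ k * d).trans (hk1.trans hd'1)
    have h2 : k * ((c - c * η / 64) * X) = (c - c * η / 64) * s * Y := by
      rw [mul_assoc, ← hkm]; ring
    rw [h2] at h1
    have h3 := le_of_mul_le_mul_right h1 hY
    nlinarith

lemma one_sub_mul_le_mul_sq {η s n r : ℝ} (hη0 : 0 ≤ η) (hη2 : η ≤ 1 / 2) (hs : 1 - η / 16 ≤ s)
    (hn : 0 ≤ n) (hr : n * (1 - η / 2) ≤ r) : (1 - η) * n ≤ r * s ^ 2 := by
  have h1 : 1 - η / 8 ≤ s ^ 2 := by nlinarith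
  have h2 : 1 - η ≤ (1 - η / 2) * (1 - η / 8) := by nlinarith
  calc (1 - η) * n ≤ (1 - η / 2) * (1 - η / 8) * n := by gcongr
    _ = n * (1 - η / 2) * (1 - η / 8) := by ring
    _ ≤ r * s ^ 2 := mul_le_mul hr h1 (by linarith) (le_trans (mul_nonneg hn (by linarith)) hr)

/-- One scale `n` bounds all much larger scales `m`, up to `ε`; this one-sided comparison suffices
for convergence. -/
lemma minDev_comparison {c ε : ℝ} (hc : 0 < c) (hε : 0 < ε) : ∃ (δ : ℝ) (N₀ : ℕ), 0 < δ ∧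
    ∀ n : ℕ, N₀ ≤ n → ∀ d : ℕ, |d / √(n : ℝ) - c| ≤ δ → ∃ N₁ : ℕ, ∀ m : ℕ, N₁ ≤ m → ∀ d' : ℕ,
      |d' / √(m : ℝ) - c| ≤ δ → minDev m d' ≤ minDev n d + ε := by
  obtain ⟨K, N₀, L, hL, hK, h⟩ := exists_regular_extremal (2 * c) hε
  have hK0 : (0 : ℝ) < K := Nat.cast_pos.mpr hK
  set e : ℝ := min (ε / L) (1 / 2) with he
  have he0 : 0 < e := by positivity
  have heL : L * e ≤ ε := by
    calc L * e ≤ L * (ε / L) := by gcongr; exact min_le_left _ _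
      _ = ε := by field_simp
  have he2 : e ≤ 1 / 2 := min_le_right _ _
  set η : ℝ := min (e / (4 * K)) (1 / 2) with hη
  have hη0 : 0 < η := by positivity
  have hη2 : η ≤ 1 / 2 := min_le_right _ _
  have hηe : 2 * K * η ≤ e / 2 := by
    calc 2 * K * η ≤ 2 * K * (e / (4 * K)) := by gcongr; exact min_le_left _ _
      _ = e / 2 := by field_simp; norm_num
  -- With `τ ≤ 4 / n`, the three thresholds give `8 K² τ ≤ e / 2`, `4 K τ ≤ 1` and `5 K ≤ n η / 2`.
  obtain ⟨N₂, hN₂⟩ := exists_nat_ge (max (64 * (K : ℝ) ^ 2 / e) (max (16 * (K : ℝ)) (10 * (K : ℝ) / η)))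
  refine ⟨c * η / 64, N₀ + N₂ + 2 * K + 1, by positivity, fun n hn d hd => ?_⟩
  have hN₂n : (N₂ : ℝ) ≤ n := by exact_mod_cast (by omega : N₂ ≤ n)
  have hn0 : (0 : ℝ) < n := by exact_mod_cast (by omega : 0 < n)
  have hn1 : 64 * K ^ 2 / e ≤ n := (le_max_left _ _).trans (hN₂.trans hN₂n)
  have hn2 : 16 * K ≤ (n : ℝ) :=
    ((le_max_left _ _).trans (le_max_right _ _)).trans (hN₂.trans hN₂n)
  have hn3 : 10 * K / η ≤ (n : ℝ) :=
    ((le_max_right _ _).trans (le_max_right _ _)).trans (hN₂.trans hN₂n)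
  have hsn : 0 < √(n : ℝ) := Real.sqrt_pos.mpr hn0
  rw [abs_le] at hd
  have hcη : c * η / 64 ≤ c / 128 := by nlinarith
  have hd1 : (d : ℝ) ≤ (c + c * η / 64) * √n := by
    rw [← div_le_iff₀ hsn]; linarith [hd.2]
  have hd2 : (c - c * η / 64) * √n ≤ d := by
    rw [← le_div_iff₀ hsn]; linarith [hd.1]
  have hd0 : (0 : ℝ) < d := lt_of_lt_of_le (mul_pos (by linarith) hsn) hd2
  obtain ⟨p, hpd, hp0, hp, hpK, hpL⟩ := h n (by omega) d (hd1.trans (by gcongr; linarith))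
  obtain ⟨N₁, hN₁⟩ := exists_nat_ge ((32 / η) ^ 2 * n)
  refine ⟨N₁ + 1, fun m hm d' hd' => ?_⟩
  have hm0 : (0 : ℝ) < m := by exact_mod_cast (by omega : 0 < m)
  have hsm : 0 < √(m : ℝ) := Real.sqrt_pos.mpr hm0
  have hmn : 32 / η * √n ≤ √m := by
    refine Real.le_sqrt_of_sq_le ?_
    rw [mul_pow, Real.sq_sqrt hn0.le]
    exact hN₁.trans (by exact_mod_cast (by omega : N₁ ≤ m))
  rw [abs_le] at hd'
  have hd'1 : (d' : ℝ) ≤ (c + c * η / 64) * √m := by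
    rw [← div_le_iff₀ hsm]; linarith [hd'.2]
  have hd'2 : (c - c * η / 64) * √m ≤ d' := by
    rw [← le_div_iff₀ hsm]; linarith [hd'.1]
  obtain ⟨k, hk⟩ : ∃ k, k = d' / d := ⟨_, rfl⟩
  have hkd : k * d ≤ d' := hk ▸ Nat.div_mul_le_self d' d
  have hk1 : (k : ℝ) * d ≤ d' := by exact_mod_cast hkd
  have hk2 : (d' : ℝ) ≤ (k + 1) * d := by
    have : d' < d * (k + 1) := hk ▸ Nat.lt_mul_div_succ d' (by exact_mod_cast hd0)
    rw [mul_comm]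
    exact_mod_cast this.le
  -- The rescaling uses `τ = s² / n`, which is `k² / m`; `s ≈ 1` makes the image of `[2K, m]` nearly
  -- fill `[0, n]`.
  obtain ⟨s, hs⟩ : ∃ s : ℝ, s = k * √n / √m := ⟨_, rfl⟩
  obtain ⟨hs1, hs2⟩ := rescaling_ratio_bounds hc hη0 hη2 hsn hsm hmn (Nat.cast_nonneg k) hd1 hd2
    hd'1 hd'2 hk1 hk2
  rw [← hs] at hs1 hs2
  have hs0 : 0 < s := by linarith
  have hτ4 : s ^ 2 / n ≤ 4 / n := by gcongr; nlinarith
  have hτK : 8 * K ^ 2 * (s ^ 2 / n) ≤ e / 2 := by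
    calc 8 * (K : ℝ) ^ 2 * (s ^ 2 / n) ≤ 8 * (K : ℝ) ^ 2 * (4 / n) := by gcongr
      _ = 32 * (K : ℝ) ^ 2 / n := by ring
      _ ≤ e / 2 := by
        rw [div_le_iff₀ he0] at hn1
        rw [div_le_iff₀ hn0]
        linarith
  refine minDev_le_of_rescaling hpd hp0 hp hpK hpL hK hL.le hε.le (by omega) hη0.le hη2
    (τ := s ^ 2 / n) (by positivity) (k := k) ?_ hkd ?_ (by omega)
    (by linarith) ?_ ?_
  · rw [hs, div_pow, mul_pow, Real.sq_sqrt hn0.le, Real.sq_sqrt hm0.le]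
    field_simp
  · calc 4 * (K : ℝ) * (s ^ 2 / n) ≤ 4 * (K : ℝ) * (4 / n) := by gcongr
      _ = 16 * (K : ℝ) / n := by ring
      _ ≤ 1 := by rw [div_le_one hn0]; exact hn2
  · calc L * _ ≤ L * e := by gcongr; linarith
      _ ≤ ε := heL
  · rw [div_div_eq_mul_div, div_le_iff₀ (by positivity)]
    rw [div_le_iff₀ hη0] at hn3
    exact one_sub_mul_le_mul_sq hη0.le hη2 hs1 hn0.le (by linarith)

/-- Fixing `n` gives `limsup a ≤ a n + ε`; letting `n` vary gives `limsup a ≤ liminf a + ε`. -/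
lemma exists_tendsto_of_eventually_le_add {a : ℕ → ℝ} {b B : ℝ} (hb : ∀ n, b ≤ a n)
    (hB : ∀ n, a n ≤ B) (h : ∀ ε : ℝ, 0 < ε → ∀ᶠ n in atTop, ∀ᶠ m in atTop, a m ≤ a n + ε) :
    ∃ l, Tendsto a atTop (𝓝 l) := by
  have hb1 : IsBoundedUnder (· ≤ ·) atTop a := isBoundedUnder_of ⟨B, hB⟩
  have hb2 : IsBoundedUnder (· ≥ ·) atTop a := isBoundedUnder_of ⟨b, hb⟩
  refine ⟨limsup a atTop, tendsto_of_le_liminf_of_limsup_le ?_ le_rfl hb1 hb2⟩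
  refine le_of_forall_pos_le_add fun ε hε => ?_
  rw [← sub_le_iff_le_add]
  refine le_liminf_of_le hb1.isCoboundedUnder_ge ?_
  filter_upwards [h ε hε] with n hn
  rw [sub_le_iff_le_add]
  exact limsup_le_of_le hb2.isCoboundedUnder_le hn

theorem exists_tendsto_minDev {d : ℕ → ℕ} {c : ℝ} (hc : 0 < c)
    (hd : Tendsto (fun n : ℕ => (d n : ℝ) / √(n : ℝ)) atTop (𝓝 c)) :
    ∃ l, Tendsto (fun n => minDev n (d n)) atTop (𝓝 l) := by
  refine exists_tendsto_of_eventually_le_add (fun n => minDev_nonneg n (d n))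
    (fun n => minDev_le_one n (d n)) fun ε hε => ?_
  obtain ⟨δ, N₀, hδ, h⟩ := minDev_comparison hc hε
  have hev : ∀ᶠ n : ℕ in atTop, |d n / √(n : ℝ) - c| ≤ δ := by
    filter_upwards [hd (Metric.closedBall_mem_nhds c hδ)] with n hn
    simpa [Real.dist_eq] using hn
  filter_upwards [hev, eventually_ge_atTop N₀] with n hn hn0
  obtain ⟨N₁, hN₁⟩ := h n hn0 (d n) hn
  filter_upwards [hev, eventually_ge_atTop N₁] with m hm hm1
  exact hN₁ m hm1 (d m) hm

end Comparison

/-! ### Asymptotics of the discrete Chebyshev problem -/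

section MinDevAsymptotics

lemma sq_div_le_one {d n : ℝ} (hd0 : 0 ≤ d) (hn : 0 < n) (hd : d ≤ √n) : d ^ 2 / n ≤ 1 := by
  rw [div_le_one hn, ← Real.sq_sqrt hn.le]
  gcongr

theorem isTheta_one_sub_minDev_sq {d : ℕ → ℕ}
    (hd : (fun n : ℕ => (d n : ℝ)) =o[atTop] (fun n : ℕ => √(n : ℝ))) :
    (fun n : ℕ => 1 - minDev n (d n) ^ 2) =Θ[atTop] (fun n : ℕ => (d n : ℝ) ^ 2 / (n : ℝ)) := by
  obtain ⟨c, hc⟩ := exists_one_sub_minDev_le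
  have hle : ∀ᶠ n : ℕ in atTop, (d n : ℝ) ≤ √(n : ℝ) := by
    filter_upwards [hd.bound one_pos] with n hn
    rw [one_mul, Real.norm_of_nonneg (Nat.cast_nonneg _),
      Real.norm_of_nonneg (Real.sqrt_nonneg _)] at hn
    exact hn
  constructor
  · refine IsBigO.of_bound (2 * c) ?_
    filter_upwards [hc, hle] with n hn hdn
    have h0 := minDev_nonneg n (d n)
    have h1 := minDev_le_one n (d n)
    rw [Real.norm_of_nonneg (by nlinarith), Real.norm_of_nonneg (by positivity)]
    nlinarith [hn (d n) hdn]
  -- For `x = d²/n ≤ 1`, `1 - (1 + 2x)⁻¹ = 2x / (1 + 2x) ≥ 2x / 3`, and squaring `minDev ≤ 1` only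
  -- enlarges the gap.
  · refine IsBigO.of_bound (3 / 2) ?_
    filter_upwards [hle, eventually_ge_atTop 2] with n hdn hn2
    have hn0 : (0 : ℝ) < n := by exact_mod_cast (by omega : 0 < n)
    have h0 := minDev_nonneg n (d n)
    have h1 := minDev_le_one n (d n)
    have h2 := minDev_le_inv hn2 (d n)
    have h3 := sq_div_le_one (Nat.cast_nonneg (d n)) hn0 hdn
    rw [Real.norm_of_nonneg (by positivity), Real.norm_of_nonneg (by nlinarith)]
    set x : ℝ := (d n : ℝ) ^ 2 / n
    have hx : 0 ≤ x := by positivity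
    rw [← one_div, le_div_iff₀ (by positivity)] at h2
    nlinarith

theorem minDev_sq_mem_Icc {d : ℕ → ℕ} {c C : ℝ} (hc : 0 < c)
    (h1 : ∀ᶠ n : ℕ in atTop, c * √(n : ℝ) ≤ d n) (h2 : ∀ᶠ n : ℕ in atTop, (d n : ℝ) ≤ C * √(n : ℝ)) :
    ∃ a b : ℝ, 0 < a ∧ b < 1 ∧ ∀ᶠ n : ℕ in atTop, minDev n (d n) ^ 2 ∈ Set.Icc a b := by
  obtain ⟨a, ha, hC⟩ := exists_le_minDev C
  refine ⟨a ^ 2, ((1 + 2 * c ^ 2)⁻¹) ^ 2, by positivity, ?_, ?_⟩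
  · exact pow_lt_one₀ (by positivity) (inv_lt_one_of_one_lt₀ (by linarith [pow_pos hc 2])) two_ne_zero
  · filter_upwards [h1, h2, hC, eventually_ge_atTop 2] with n hn1 hn2 hn3 hn
    have hn0 : (0 : ℝ) < n := by exact_mod_cast (by omega : 0 < n)
    have h0 := minDev_nonneg n (d n)
    constructor
    · gcongr
      exact hn3 _ hn2
    · have h3 : c ^ 2 ≤ (d n : ℝ) ^ 2 / n := by
        rw [le_div_iff₀ hn0]
        calc c ^ 2 * n = (c * √(n : ℝ)) ^ 2 := by rw [mul_pow, Real.sq_sqrt hn0.le]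
          _ ≤ _ := by gcongr
      gcongr
      refine (minDev_le_inv hn (d n)).trans ?_
      gcongr

theorem minDev_sq_mem_Icc_of_isTheta {d : ℕ → ℕ}
    (hd : (fun n : ℕ => (d n : ℝ)) =Θ[atTop] (fun n : ℕ => √(n : ℝ))) :
    ∃ a b : ℝ, 0 < a ∧ b < 1 ∧ ∀ᶠ n : ℕ in atTop, minDev n (d n) ^ 2 ∈ Set.Icc a b := by
  obtain ⟨C, -, hC⟩ := hd.1.exists_pos
  obtain ⟨c, hc0, hc⟩ := hd.2.exists_pos
  refine minDev_sq_mem_Icc (c := c⁻¹) (C := C) (inv_pos.mpr hc0) ?_ ?_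
  · filter_upwards [hc.bound] with n hn
    rw [Real.norm_of_nonneg (Nat.cast_nonneg _), Real.norm_of_nonneg (Real.sqrt_nonneg _)] at hn
    rwa [inv_mul_le_iff₀ hc0]
  · filter_upwards [hC.bound] with n hn
    rwa [Real.norm_of_nonneg (Nat.cast_nonneg _), Real.norm_of_nonneg (Real.sqrt_nonneg _)] at hn

theorem exists_tendsto_minDev_sq {d : ℕ → ℕ} {c : ℝ} (hc : 0 < c)
    (hd : Tendsto (fun n : ℕ => (d n : ℝ) / √(n : ℝ)) atTop (𝓝 c)) :
    ∃ l ∈ Set.Ioo (0 : ℝ) 1, Tendsto (fun n : ℕ => minDev n (d n) ^ 2) atTop (𝓝 l) := by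
  obtain ⟨l, hl⟩ := exists_tendsto_minDev hc hd
  have hl2 := hl.pow 2
  have hsqrt : ∀ᶠ n : ℕ in atTop, 0 < √(n : ℝ) := by
    filter_upwards [eventually_gt_atTop 0] with n hn
    exact Real.sqrt_pos.mpr (by exact_mod_cast hn)
  obtain ⟨a, b, ha, hb, hab⟩ := minDev_sq_mem_Icc (d := d) (c := c / 2) (C := 2 * c) (by positivity)
    (by
      filter_upwards [hsqrt, hd.eventually_const_le (u := c / 2) (by linarith)] with n hn h
      rwa [le_div_iff₀ hn] at h)
    (by
      filter_upwards [hsqrt, hd.eventually_le_const (u := 2 * c) (by linarith)] with n hn h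
      rwa [div_le_iff₀ hn] at h)
  have := isClosed_Icc.mem_of_tendsto hl2 hab
  exact ⟨l ^ 2, ⟨ha.trans_le this.1, this.2.trans_lt hb⟩, hl2⟩

theorem isBigO_minDev_sq (d : ℕ → ℕ) : (fun n : ℕ => minDev n (d n) ^ 2) =O[atTop]
    (fun n : ℕ => Real.exp (-4 * (d n : ℝ) / √(n : ℝ))) := by
  refine IsBigO.of_bound 4 ?_
  filter_upwards [eventually_ge_atTop 2] with n hn
  have h0 := minDev_nonneg n (d n)
  rw [Real.norm_of_nonneg (by positivity), Real.norm_of_nonneg (by positivity)]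
  calc minDev n (d n) ^ 2 ≤ (2 * Real.exp (-2 * d n / √n)) ^ 2 := by
        gcongr
        exact minDev_le_exp hn (d n)
    _ = 4 * Real.exp (-4 * d n / √n) := by
        rw [mul_pow, ← Real.exp_nat_mul]
        congr 2
        · norm_num
        · push_cast; ring

end MinDevAsymptotics

/-! ### Linear forms in the signals -/

section LinearForms

variable {n : ℕ}

/-- The linear form with coefficients `b` in the signals. -/
def linForm (b : Finset (Fin n) → ℝ) (x : Signals n) : ℝ := ∑ T, b T * x T

lemma measurable_linForm (b : Finset (Fin n) → ℝ) : Measurable (linForm b) := by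
  unfold linForm
  fun_prop

lemma target_eq_linForm : (target : Signals n → ℝ) = linForm 1 := by
  funext x
  simp [target, linForm]

lemma Prior.memLp_coord (D : Prior n) (T : Finset (Fin n)) :
    MemLp (fun x : Signals n => x T) 2 D.law :=
  (D.memLp_two T).comp_measurePreserving (measurePreserving_eval D.dist T)

lemma Prior.memLp_linForm (D : Prior n) (b : Finset (Fin n) → ℝ) : MemLp (linForm b) 2 D.law :=
  memLp_finsetSum _ fun T _ => (D.memLp_coord T).const_mul (b T)

lemma Prior.integrable_linForm (D : Prior n) (b : Finset (Fin n) → ℝ) :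
    Integrable (linForm b) D.law := (D.memLp_linForm b).integrable one_le_two

lemma Prior.integral_linForm (D : Prior n) (b : Finset (Fin n) → ℝ) :
    ∫ x, linForm b x ∂D.law = 0 := by
  unfold linForm
  rw [integral_finsetSum _ fun T _ => ((D.memLp_coord T).integrable one_le_two).const_mul _]
  refine Finset.sum_eq_zero fun T _ => ?_
  rw [integral_const_mul]
  have h2 : ∫ x : Signals n, x T ∂D.law = ∫ y, y ∂D.dist T := by
    have h := integral_map (μ := Measure.pi D.dist) (φ := Function.eval T) (f := fun y : ℝ => y)
      (measurable_pi_apply T).aemeasurable aestronglyMeasurable_id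
    rw [(measurePreserving_eval D.dist T).map_eq] at h
    exact h.symm
  rw [h2, D.mean_zero, mul_zero]

lemma Prior.lintegral_linForm_sq (D : Prior n) (b : Finset (Fin n) → ℝ) :
    ∫⁻ x, ENNReal.ofReal (linForm b x ^ 2) ∂D.law =
      ENNReal.ofReal (∑ T, b T ^ 2 * variance (fun x : ℝ => x) (D.dist T)) := by
  rw [← ofReal_integral_eq_lintegral_ofReal (D.memLp_linForm b).integrable_sq
    (Eventually.of_forall fun _ => sq_nonneg _)]
  congr 1
  rw [← variance_of_integral_eq_zero (measurable_linForm b).aemeasurable (D.integral_linForm b)]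
  have h := variance_sum_pi (μ := D.dist) (X := fun T y => b T * y)
    fun T => (D.memLp_two T).const_mul (b T)
  have e : linForm b = ∑ T, fun x : Signals n => b T * x T := by
    funext x
    simp [linForm]
  rw [e, Prior.law, h]
  refine Finset.sum_congr rfl fun T _ => ?_
  rw [variance_const_mul]

/-- The coefficients of what expert `i` observes of a linear form. -/
def restrictTo (i : Fin n) (b : Finset (Fin n) → ℝ) : Finset (Fin n) → ℝ :=
  fun T => if i ∈ T then b T else 0

lemma measurable_observe (i : Fin n) : Measurable (observe i) := by
  unfold observe
  fun_prop

lemma linForm_restrictTo (i : Fin n) (b : Finset (Fin n) → ℝ) (x : Signals n) :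
    linForm (restrictTo i b) x = ∑ T : {T : Finset (Fin n) // i ∈ T}, b T * observe i x T := by
  unfold linForm restrictTo observe
  rw [← Finset.sum_subtype (Finset.univ.filter (i ∈ ·)) (by simp) (fun T => b T * x T),
    Finset.sum_filter]
  exact Finset.sum_congr rfl fun T _ => by split_ifs <;> simp

lemma measurable_linForm_restrictTo (i : Fin n) (b : Finset (Fin n) → ℝ) :
    Measurable[agentSigma i] (linForm (restrictTo i b)) := by
  have : linForm (restrictTo i b) = (fun s : AgentSignals i =>
      ∑ T : {T : Finset (Fin n) // i ∈ T}, b T * s T) ∘ observe i := by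
    funext x
    exact linForm_restrictTo i b x
  rw [this]
  exact Measurable.comp (by fun_prop) (comap_measurable _)

lemma Prior.indep_agentSigma (D : Prior n) (i : Fin n) (b : Finset (Fin n) → ℝ) :
    Indep (MeasurableSpace.comap (linForm (b - restrictTo i b)) inferInstance) (agentSigma i)
      D.law := by
  have hind : iIndepFun (fun (T : Finset (Fin n)) (x : Signals n) => x T) D.law :=
    iIndepFun_pi (X := fun _ y => y) fun _ => aemeasurable_id
  have h := hind.indepFun_finset (Finset.univ.filter (i ∉ ·)) (Finset.univ.filter (i ∈ ·))
    (by rw [Finset.disjoint_filter]; exact fun _ _ h => h) fun T => measurable_pi_apply T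
  have h2 := h.comp
    (φ := fun s : ({T // T ∈ Finset.univ.filter (i ∉ ·)} → ℝ) => ∑ T, b T.1 * s T)
    (ψ := fun (s : ({T // T ∈ Finset.univ.filter (i ∈ ·)} → ℝ)) (T : {T : Finset (Fin n) // i ∈ T}) =>
      s ⟨T.1, by simpa using T.2⟩) (by fun_prop) (by fun_prop)
  have e : linForm (b - restrictTo i b) = (fun s : ({T // T ∈ Finset.univ.filter (i ∉ ·)} → ℝ) =>
      ∑ T, b T.1 * s T) ∘ fun (x : Signals n) T => x T.1 := by
    funext x
    simp only [Function.comp]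
    rw [Finset.sum_coe_sort (Finset.univ.filter (i ∉ ·)) (fun T => b T * x T), Finset.sum_filter]
    refine Finset.sum_congr rfl fun T _ => ?_
    by_cases hT : i ∈ T <;> simp [restrictTo, hT]
  rw [e]
  exact h2

lemma linForm_add (a b : Finset (Fin n) → ℝ) (x : Signals n) :
    linForm (a + b) x = linForm a x + linForm b x := by
  simp [linForm, add_mul, Finset.sum_add_distrib]

lemma linForm_smul (r : ℝ) (b : Finset (Fin n) → ℝ) (x : Signals n) :
    linForm (r • b) x = r * linForm b x := by
  simp [linForm, Finset.mul_sum, mul_assoc]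

lemma linForm_sum {ι : Type*} (s : Finset ι) (b : ι → Finset (Fin n) → ℝ) (x : Signals n) :
    linForm (∑ k ∈ s, b k) x = ∑ k ∈ s, linForm (b k) x := by
  simp only [linForm, Finset.sum_apply, Finset.sum_mul]
  exact Finset.sum_comm

/-- The unobserved part is independent of the expert's information and has mean zero. -/
lemma Prior.condExp_linForm (D : Prior n) (i : Fin n) (b : Finset (Fin n) → ℝ) :
    (D.law)[linForm b | agentSigma i] =ᵐ[D.law] linForm (restrictTo i b) := by
  have hle : agentSigma i ≤ (inferInstance : MeasurableSpace (Signals n)) :=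
    (measurable_observe i).comap_le
  have e : linForm b = linForm (restrictTo i b) + linForm (b - restrictTo i b) := by
    funext x
    rw [Pi.add_apply, ← linForm_add, add_sub_cancel]
  have h1 := condExp_add (D.integrable_linForm (restrictTo i b))
    (D.integrable_linForm (b - restrictTo i b)) (agentSigma i)
  rw [← e] at h1
  have h2 := condExp_of_stronglyMeasurable hle
    (measurable_linForm_restrictTo i b).stronglyMeasurable (D.integrable_linForm (restrictTo i b))
  have h3 := condExp_indep_eq (μ := D.law) (measurable_linForm (b - restrictTo i b)).comap_le hle
    (comap_measurable (linForm (b - restrictTo i b))).stronglyMeasurable (D.indep_agentSigma i b)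
  filter_upwards [h1, h3] with x hx1 hx3
  rw [hx1, Pi.add_apply, h2, hx3, D.integral_linForm, add_zero]

end LinearForms

/-! ### Priors with symmetric two-point signals -/

section TwoPoint

/-- The uniform distribution on `{a, -a}`. -/
noncomputable def twoPoint (a : ℝ) : Measure ℝ :=
  (2⁻¹ : ℝ≥0∞) • Measure.dirac a + (2⁻¹ : ℝ≥0∞) • Measure.dirac (-a)

instance isProbabilityMeasure_twoPoint (a : ℝ) : IsProbabilityMeasure (twoPoint a) :=
  ⟨by simp [twoPoint, ENNReal.inv_two_add_inv_two]⟩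

lemma integrable_twoPoint (a : ℝ) (f : ℝ → ℝ) : Integrable f (twoPoint a) := by
  refine Integrable.add_measure ?_ ?_ <;>
  exact (integrable_dirac (by simp)).smul_measure (by simp)

lemma integral_twoPoint (a : ℝ) (f : ℝ → ℝ) : ∫ x, f x ∂twoPoint a = (f a + f (-a)) / 2 := by
  rw [twoPoint, integral_add_measure ((integrable_dirac (by simp)).smul_measure (by simp))
    ((integrable_dirac (by simp)).smul_measure (by simp))]
  simp
  ring

lemma memLp_two_twoPoint (a : ℝ) : MemLp (fun x : ℝ => x) 2 (twoPoint a) :=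
  (memLp_two_iff_integrable_sq aestronglyMeasurable_id).mpr (integrable_twoPoint a _)

lemma variance_twoPoint (a : ℝ) : variance (fun x : ℝ => x) (twoPoint a) = a ^ 2 := by
  rw [variance_of_integral_eq_zero aemeasurable_id' (by simp [integral_twoPoint]),
    integral_twoPoint]
  ring

lemma twoPoint_zero : twoPoint 0 = Measure.dirac 0 := by
  rw [twoPoint, neg_zero, ← add_smul, ENNReal.inv_two_add_inv_two, one_smul]

lemma twoPoint_singleton_ne_zero (a : ℝ) {b : ℝ} (hb : b = a ∨ b = -a) :
    twoPoint a {b} ≠ 0 := by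
  rcases hb with rfl | rfl <;> simp [twoPoint]

/-- The prior for which `X_T` is uniform on `{v T, -v T}`. -/
noncomputable def symmPrior {n : ℕ} (v : Finset (Fin n) → ℝ) (h0 : v ∅ = 0)
    (hne : ∃ T, v T ≠ 0) : Prior n where
  dist T := twoPoint (v T)
  isProb _ := inferInstance
  memLp_two T := memLp_two_twoPoint (v T)
  mean_zero T := by simp [integral_twoPoint]
  dist_empty := by rw [h0, twoPoint_zero]
  exists_var_pos := hne.imp fun T hT => by rw [variance_twoPoint]; positivity

/-- Every sign pattern is an atom of positive mass, so almost sure statements hold there pointwise.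
-/
lemma symmPrior_of_ae {n : ℕ} {v : Finset (Fin n) → ℝ} {h0 : v ∅ = 0} {hne : ∃ T, v T ≠ 0}
    {p : Signals n → Prop} (hp : ∀ᵐ x ∂(symmPrior v h0 hne).law, p x) {x : Signals n}
    (hx : ∀ T, x T = v T ∨ x T = -v T) : p x := by
  by_contra hcon
  have h1 : (symmPrior v h0 hne).law {x} = 0 :=
    measure_mono_null (Set.singleton_subset_iff.mpr hcon) (ae_iff.mp hp)
  rw [Prior.law, Measure.pi_singleton, Finset.prod_eq_zero_iff] at h1
  obtain ⟨T, -, hT⟩ := h1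
  exact twoPoint_singleton_ne_zero (v T) (hx T) hT

end TwoPoint

/-! ### The form of linear aggregation rules -/

section Structure

variable {n m : ℕ}

lemma wellFounded_adj {V : Type*} [Finite V] {G : Digraph V}
    (h : ∀ v, ¬ Relation.TransGen G.Adj v v) : WellFounded fun w v => G.Adj v w := by
  have : IsTrans V fun w v => Relation.TransGen G.Adj v w := ⟨fun _ _ _ h1 h2 => h2.trans h1⟩
  have : Std.Irrefl fun w v => Relation.TransGen G.Adj v w := ⟨h⟩
  exact Subrelation.wf (r := fun w v => Relation.TransGen G.Adj v w) Relation.TransGen.single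
    (Finite.wellFounded_of_trans_of_irrefl _)

lemma Query.measurable_out (Q : Query n) (D : Prior n) : Measurable (Q.out D) :=
  (Q.measurable_answer D).comp (measurable_observe Q.agent)

lemma measurable_target : Measurable (target : Signals n → ℝ) := by
  rw [target_eq_linForm]; exact measurable_linForm 1

lemma measurable_nodeVar (𝒬 : Fin m → Query n) (v : Option (Fin m)) (D : Prior n) :
    Measurable (nodeVar 𝒬 v D) := by
  cases v with
  | none => exact measurable_target
  | some j => exact (𝒬 j).measurable_out D

open Classical in
/-- In a linear aggregation rule all the queries are linear forms in the signals, with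
coefficients that do not depend on the prior. -/
lemma exists_nodeVar_coeff {𝒬 : Fin m → Query n} {G : Digraph (Option (Fin m))}
    (hG : ∀ v, ¬ Relation.TransGen G.Adj v v) {α : Fin m → Option (Fin m) → ℝ}
    (hα : ∀ (j : Fin m) (D : Prior n), (𝒬 j).out D =ᵐ[D.law]
      (D.law)[fun x => ∑ v with G.Adj (some j) v, α j v * nodeVar 𝒬 v D x |
        agentSigma (𝒬 j).agent]) :
    ∃ c : Option (Fin m) → Finset (Fin n) → ℝ, c none = 1 ∧
      (∀ j, restrictTo (𝒬 j).agent (c (some j)) = c (some j)) ∧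
      ∀ v D, nodeVar 𝒬 v D =ᵐ[D.law] linForm (c v) := by
  suffices h : ∀ v, ∃ b : Finset (Fin n) → ℝ, (v = none → b = 1) ∧
      (∀ j, v = some j → restrictTo (𝒬 j).agent b = b) ∧
      ∀ D, nodeVar 𝒬 v D =ᵐ[D.law] linForm b by
    choose c h1 h2 h3 using h
    exact ⟨c, h1 none rfl, fun j => h2 (some j) j rfl, h3⟩
  intro v
  induction v using (wellFounded_adj hG).induction with
  | _ v ih =>
    cases v with
    | none =>
      refine ⟨1, fun _ => rfl, by simp, fun D => ?_⟩
      exact Eventually.of_forall fun x => congrFun target_eq_linForm x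
    | some j =>
      choose! b _ _ hb using ih
      refine ⟨restrictTo (𝒬 j).agent (∑ v with G.Adj (some j) v, α j v • b v), by simp,
        fun k hk => ?_, fun D => ?_⟩
      · obtain rfl := Option.some.inj hk
        funext T
        simp only [restrictTo]
        split_ifs <;> rfl
      · refine (hα j D).trans (EventuallyEq.trans ?_ (D.condExp_linForm _ _))
        refine condExp_congr_ae ?_
        have h : ∀ᵐ x ∂D.law, ∀ v, G.Adj (some j) v → nodeVar 𝒬 v D x = linForm (b v) x := by
          rw [ae_all_iff]
          intro v
          by_cases hv : G.Adj (some j) v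
          · filter_upwards [hb v hv D] with x hx _ using hx
          · exact Eventually.of_forall fun _ h => absurd h hv
        filter_upwards [h] with x hx
        rw [linForm_sum]
        refine Finset.sum_congr rfl fun v hv => ?_
        rw [linForm_smul, hx v (Finset.mem_filter.mp hv).2]

/-- Finite-dimensional duality: a functional that vanishes on the common kernel of others is a
combination of them. -/
lemma mem_span_range_of_forall_sum_eq_zero {ι I : Type*} [Finite ι] [Fintype I] {q : I → ℝ}
    {c : ι → I → ℝ} (h : ∀ v : I → ℝ, (∀ u, ∑ T, c u T * v T = 0) → ∑ T, q T * v T = 0) :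
    q ∈ Submodule.span ℝ (Set.range c) := by
  classical
  have := Fintype.ofFinite ι
  let L : (I → ℝ) → ((I → ℝ) →ₗ[ℝ] ℝ) := fun b => ∑ T, b T • LinearMap.proj T
  have hL : ∀ b v, L b v = ∑ T, b T * v T := fun b v => by simp [L]
  have hmem : L q ∈ Submodule.span ℝ (Set.range fun u => L (c u)) := by
    refine mem_span_of_iInf_ker_le_ker fun v hv => ?_
    rw [LinearMap.mem_ker, hL]
    refine h v fun u => ?_
    rw [← hL]
    exact (Submodule.mem_iInf _).mp hv u
  obtain ⟨a, ha⟩ := (Submodule.mem_span_range_iff_exists_fun ℝ).mp hmem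
  refine (Submodule.mem_span_range_iff_exists_fun ℝ).mpr ⟨a, ?_⟩
  funext T
  have := congrArg (fun l => l (Pi.single T 1)) ha
  simpa [hL, LinearMap.sum_apply, Pi.single_apply] using this

/-- If two observations of an expert give the same conditional law of the reference variables,
then the answers to an elicitable query agree. -/
lemma Elicitable.sum_eq_zero {κ : Type} [Countable κ] {Q : Query n}
    {R : κ → Prior n → Signals n → ℝ} (hQ : Elicitable Q R) {q : Finset (Fin n) → ℝ}
    {c : κ → Finset (Fin n) → ℝ} (hq : ∀ D, Q.out D =ᵐ[D.law] linForm q)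
    (hc : ∀ u D, R u D =ᵐ[D.law] linForm (c u)) {v : Finset (Fin n) → ℝ}
    (hv : restrictTo Q.agent v = v) (h : ∀ u, ∑ T, c u T * v T = 0) : ∑ T, q T * v T = 0 := by
  by_cases hne : ∃ T, v T ≠ 0
  swap
  · push Not at hne
    simp [hne]
  have hv0 : ∀ T, Q.agent ∉ T → v T = 0 := fun T hT => by
    rw [← hv]; simp [restrictTo, hT]
  obtain ⟨π, hπ⟩ := hQ
  -- Under this prior every nonconstant signal is seen by the expert, so the references are
  -- functions `F` of the observation and their conditional laws are Dirac masses.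
  set D := symmPrior v (hv0 ∅ (Finset.notMem_empty _)) hne with hD
  let F : AgentSignals Q.agent → κ → ℝ := fun s u =>
    ∑ T : {T : Finset (Fin n) // Q.agent ∈ T}, c u T * s T
  have hF : Measurable F := by fun_prop
  have hzero : ∀ᵐ x ∂D.law, ∀ T, Q.agent ∉ T → x T = 0 := by
    rw [ae_all_iff]
    intro T
    by_cases hT : Q.agent ∈ T
    · exact Eventually.of_forall fun _ h => absurd hT h
    · have h1 : ∀ᵐ y ∂D.dist T, y = 0 := by
        have : D.dist T = Measure.dirac 0 := by
          rw [← twoPoint_zero, ← hv0 T hT]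
          rfl
        rw [this, ae_dirac_eq]
        rfl
      have h2 := (measurePreserving_eval D.dist T).quasiMeasurePreserving.ae h1
      filter_upwards [h2] with x hx _ using hx
  have hY : (fun y u => R u D y) =ᵐ[D.law] F ∘ observe Q.agent := by
    filter_upwards [ae_all_iff.mpr fun u => hc u D, hzero] with x hx h0
    funext u
    rw [hx u]
    change _ = ∑ T : {T : Finset (Fin n) // Q.agent ∈ T}, c u T * observe Q.agent x T
    rw [← linForm_restrictTo]
    refine Finset.sum_congr rfl fun T _ => ?_
    by_cases hT : Q.agent ∈ T
    · simp [restrictTo, hT]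
    · simp [h0 T hT]
  have hν := ae_of_ae_map (measurable_observe Q.agent).aemeasurable
    (condDistrib_comp_self (μ := D.law) (observe Q.agent) hF)
  rw [← condDistrib_congr hY (EventuallyEq.refl _ (observe Q.agent))] at hν
  have hall := (hπ D).and (hν.and (hq D))
  have hpos := symmPrior_of_ae hall (x := v) fun T => Or.inl rfl
  have hneg := symmPrior_of_ae hall (x := -v) fun T => Or.inr rfl
  have hlin : ∀ b, linForm b (-v) = -linForm b v := fun b => by simp [linForm]
  have hFv : F (observe Q.agent v) = 0 := by
    funext u
    change ∑ T : {T : Finset (Fin n) // Q.agent ∈ T}, c u T * observe Q.agent v T = 0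
    rw [← linForm_restrictTo, ← h u]
    refine Finset.sum_congr rfl fun T _ => ?_
    by_cases hT : Q.agent ∈ T
    · simp [restrictTo, hT]
    · simp [hv0 T hT]
  have hFnv : F (observe Q.agent (-v)) = 0 := by
    funext u
    change ∑ T : {T : Finset (Fin n) // Q.agent ∈ T}, c u T * observe Q.agent (-v) T = 0
    rw [← linForm_restrictTo, hlin, linForm_restrictTo]
    have := congrFun hFv u
    change ∑ T : {T : Finset (Fin n) // Q.agent ∈ T}, c u T * observe Q.agent v T = 0 at this
    rw [this, neg_zero]
  obtain ⟨⟨-, hmax1⟩, hν1, hq1⟩ := hpos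
  obtain ⟨⟨-, hmax2⟩, hν2, hq2⟩ := hneg
  rw [Kernel.deterministic_apply, hFv] at hν1
  rw [Kernel.deterministic_apply, hFnv] at hν2
  rw [hν1] at hmax1
  rw [hν2] at hmax2
  -- At the observations of `v` and `-v` the references all vanish, so the two maximization problems
  -- coincide and have one maximizer; but the answers are `q · v` and `-q · v`.
  have heq : Q.out D v = Q.out D (-v) := by
    by_contra hcon
    exact lt_asymm (hmax1 _ (Ne.symm hcon)) (hmax2 _ hcon)
  rw [hq1, hq2, hlin] at heq
  change linForm q v = 0
  linarith

/-- The coefficients of the linear form `∑_{T ⊇ S} X_T`. -/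
def upperIndicator (S : Finset (Fin n)) : Finset (Fin n) → ℝ := fun T => if S ⊆ T then 1 else 0

lemma restrictTo_upperIndicator (i : Fin n) (S : Finset (Fin n)) :
    restrictTo i (upperIndicator S) = upperIndicator (insert i S) := by
  funext T
  simp only [restrictTo, upperIndicator, Finset.insert_subset_iff]
  split_ifs <;> simp_all

lemma upperIndicator_empty : upperIndicator (∅ : Finset (Fin n)) = 1 := by
  funext T
  simp [upperIndicator]

lemma restrictTo_mem_span {i : Fin n} {p p' : Finset (Fin n) → Prop}
    (h : ∀ S, p S → p' (insert i S)) {b : Finset (Fin n) → ℝ}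
    (hb : b ∈ Submodule.span ℝ (upperIndicator '' {S | p S})) :
    restrictTo i b ∈ Submodule.span ℝ (upperIndicator '' {S | p' S}) := by
  induction hb using Submodule.span_induction with
  | mem x hx =>
    obtain ⟨S, hS, rfl⟩ := hx
    rw [restrictTo_upperIndicator]
    exact Submodule.subset_span ⟨_, h S hS, rfl⟩
  | zero =>
    convert Submodule.zero_mem _
    funext T
    simp [restrictTo]
  | add x y _ _ hx hy =>
    convert Submodule.add_mem _ hx hy
    funext T
    simp only [restrictTo, Pi.add_apply]
    split_ifs <;> simp
  | smul a x _ hx =>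
    convert Submodule.smul_mem _ a hx
    funext T
    simp [restrictTo]

/-- The coefficients of a query are spanned by the indicators of sets of relevant experts. -/
lemma coeff_mem_span {𝒬 : Fin m → Query n} {G : Digraph (Option (Fin m))} (hG : DAGElicits 𝒬 G)
    {c : Option (Fin m) → Finset (Fin n) → ℝ} (hc1 : c none = 1)
    (hc2 : ∀ j, restrictTo (𝒬 j).agent (c (some j)) = c (some j))
    (hc3 : ∀ v D, nodeVar 𝒬 v D =ᵐ[D.law] linForm (c v)) (j : Fin m) :
    c (some j) ∈ Submodule.span ℝ
      (upperIndicator '' {S | S.Nonempty ∧ (S : Set (Fin n)) ⊆ relevantAgents 𝒬 G j}) := by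
  suffices h : ∀ v, ∀ j, v = some j → c (some j) ∈ Submodule.span ℝ
      (upperIndicator '' {S | S.Nonempty ∧ (S : Set (Fin n)) ⊆ relevantAgents 𝒬 G j}) from h _ j rfl
  intro v
  induction v using (wellFounded_adj hG.1).induction with
  | _ v ih =>
    rintro j rfl
    have hself : (𝒬 j).agent ∈ relevantAgents 𝒬 G j := ⟨j, .refl, rfl⟩
    -- This uses elicitability alone, not the linear formula for the answers, so it holds for every
    -- graph that elicits the list.
    have hmem : c (some j) ∈ Submodule.span ℝ (Set.range
        fun u : {v : Option (Fin m) // G.Adj (some j) v} => restrictTo (𝒬 j).agent (c u.1)) := by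
      refine mem_span_range_of_forall_sum_eq_zero fun v hv => ?_
      have hswap : ∀ b : Finset (Fin n) → ℝ, ∑ T, b T * restrictTo (𝒬 j).agent v T =
          ∑ T, restrictTo (𝒬 j).agent b T * v T := fun b =>
        Finset.sum_congr rfl fun T _ => by simp only [restrictTo]; split_ifs <;> simp
      have := (hG.2.2 j).sum_eq_zero (q := c (some j))
        (c := fun u : {v : Option (Fin m) // G.Adj (some j) v} => c u.1) (hc3 (some j))
        (fun u D => hc3 u.1 D) (v := restrictTo (𝒬 j).agent v) ?_ ?_
      · rwa [hswap, hc2] at this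
      · funext T
        simp only [restrictTo]
        split_ifs <;> rfl
      · intro u
        rw [hswap]
        exact hv u
    refine (Submodule.span_le.mpr ?_) hmem
    rintro _ ⟨⟨u, hu⟩, rfl⟩
    cases u with
    | none =>
      change restrictTo _ (c none) ∈ _
      rw [hc1, ← upperIndicator_empty, restrictTo_upperIndicator]
      refine Submodule.subset_span ⟨_, ⟨Finset.insert_nonempty _ _, ?_⟩, rfl⟩
      simpa using hself
    | some k =>
      refine restrictTo_mem_span (fun S hS => ⟨Finset.insert_nonempty _ _, ?_⟩) (ih _ hu k rfl)
      rw [Finset.coe_insert, Set.insert_subset_iff]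
      refine ⟨hself, fun i hi => ?_⟩
      obtain ⟨l, hl, hli⟩ := hS.2 hi
      exact ⟨l, .head hu hl, hli⟩

/-- The linear forms in the signals whose coefficients are polynomials of degree at most `d`
without constant term in the indicators of the experts. -/
def lowDegree (n d : ℕ) : Submodule ℝ (Finset (Fin n) → ℝ) :=
  Submodule.span ℝ (upperIndicator '' {S | S.Nonempty ∧ S.card ≤ d})

lemma exists_dagElicits_of_agentComplexity_le {𝒬 : Fin m → Query n} {d : ℕ}
    (h : agentComplexity 𝒬 ≤ d) :
    ∃ G, DAGElicits 𝒬 G ∧ ∀ j, (relevantAgents 𝒬 G j).encard ≤ d := by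
  -- A strict bound by `d + 1` on the infimum yields a graph; integrality brings the bound back to
  -- `d`.
  have h1 : agentComplexity 𝒬 < (d + 1 : ℕ) :=
    h.trans_lt (by exact_mod_cast Nat.lt_succ_self d)
  simp only [agentComplexity, iInf_lt_iff] at h1
  obtain ⟨G, hG, hlt⟩ := h1
  refine ⟨G, hG, fun j => ?_⟩
  have h2 := (le_iSup (fun j => (relevantAgents 𝒬 G j).encard) j).trans_lt hlt
  push_cast at h2
  exact Order.le_of_lt_add_one h2

/-- Two graphs are in play: `G` witnesses linearity and provides the coefficients, while `G'`
witnesses the agent complexity and bounds their degree. -/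
theorem AggregationRule.IsLinear.exists_output_eq_linForm {R : AggregationRule n} (hR : R.IsLinear)
    {d : ℕ} (hd : agentComplexity R.query ≤ d) :
    ∃ c ∈ lowDegree n d, ∀ D : Prior n, R.output D =ᵐ[D.law] linForm c := by
  obtain ⟨⟨G, hG, α, hα⟩, β, hβ⟩ := hR
  obtain ⟨c, hc1, hc2, hc3⟩ := exists_nodeVar_coeff hG.1 hα
  obtain ⟨G', hG', hcard⟩ := exists_dagElicits_of_agentComplexity_le hd
  refine ⟨∑ j, β j • c (some j), ?_, fun D => ?_⟩
  · refine Submodule.sum_mem _ fun j _ => Submodule.smul_mem _ _ ?_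
    refine Submodule.span_mono (Set.image_mono ?_) (coeff_mem_span hG' hc1 hc2 hc3 j)
    rintro S ⟨hS, hSj⟩
    refine ⟨hS, ?_⟩
    have := (Set.encard_le_encard hSj).trans (hcard j)
    rw [Set.encard_coe_eq_coe_finsetCard] at this
    exact_mod_cast this
  · filter_upwards [ae_all_iff.mpr fun j => hc3 (some j) D] with x hx
    rw [AggregationRule.output, hβ, linForm_sum]
    exact Finset.sum_congr rfl fun j _ => by rw [linForm_smul, ← hx j]; rfl

end Structure

/-! ### The lower bound on the error -/

section LowerBound

open Polynomial

/-- By Hahn-Banach, a norming functional for the class of `1` in the quotient by `devSpace n d`,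
whose norm is the distance `minDev n d`. -/
lemma exists_dual_devSpace (n d : ℕ) : ∃ l : Fin n → ℝ, ∑ k, |l k| ≤ 1 ∧
    (∀ v ∈ devSpace n d, ∑ k, l k * v k = 0) ∧ ∑ k, l k = minDev n d := by
  obtain ⟨g, hg1, hg⟩ := exists_dual_vector'' ℝ
    ((devSpace n d).mkQ (1 : Fin n → ℝ) : (Fin n → ℝ) ⧸ devSpace n d)
  set f : (Fin n → ℝ) →ₗ[ℝ] ℝ := g.toLinearMap ∘ₗ (devSpace n d).mkQ with hf
  have hsum : ∀ v, f v = ∑ k, f (Pi.single k 1) * v k := fun v => by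
    rw [LinearMap.pi_apply_eq_sum_univ f v]
    refine Finset.sum_congr rfl fun k _ => ?_
    have e : (fun j => if k = j then (1 : ℝ) else 0) = Pi.single k 1 := by
      funext j
      simp [Pi.single_apply, eq_comm]
    rw [smul_eq_mul, mul_comm, e]
  have hnorm : ∀ v, |f v| ≤ ‖v‖ := fun v => by
    have h1 : ‖(devSpace n d).mkQ v‖ ≤ ‖v‖ := Submodule.Quotient.norm_mk_le _ _
    have h2 := g.le_of_opNorm_le hg1 ((devSpace n d).mkQ v)
    rw [one_mul] at h2
    exact h2.trans h1
  refine ⟨fun k => f (Pi.single k 1), ?_, fun v hv => ?_, ?_⟩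
  -- The dual of the sup norm is the `ℓ¹` norm, as seen on the vector of signs.
  · have h1 := hnorm fun k => SignType.sign (f (Pi.single k 1))
    rw [hsum] at h1
    simp only [self_mul_sign] at h1
    refine (le_abs_self _).trans (h1.trans ?_)
    rw [pi_norm_le_iff_of_nonneg zero_le_one]
    intro k
    rcases SignType.sign (f (Pi.single k 1)) with _ | _ | _ <;> simp
  · rw [← hsum]
    simp [hf, (Submodule.Quotient.mk_eq_zero _).mpr hv]
  · have h1 := hsum 1
    simp only [Pi.one_apply, mul_one] at h1
    rw [← h1]
    change g _ = _
    rw [hg]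
    exact QuotientAddGroup.norm_mk (S := (devSpace n d).toAddSubgroup) (1 : Fin n → ℝ)

lemma exists_dual_weights (n d : ℕ) : ∃ l : ℕ → ℝ, l 0 = 0 ∧
    ∑ k ∈ Finset.range (n + 1), |l k| ≤ 1 ∧
    (∀ q : ℝ[X], q.natDegree ≤ d → q.eval 0 = 0 →
      ∑ k ∈ Finset.range (n + 1), l k * q.eval (k : ℝ) = 0) ∧
    ∑ k ∈ Finset.range (n + 1), l k = minDev n d := by
  obtain ⟨l, h1, h2, h3⟩ := exists_dual_devSpace n d
  let l' : ℕ → ℝ := fun k => if h : k ≠ 0 ∧ k - 1 < n then l ⟨k - 1, h.2⟩ else 0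
  have h0 : l' 0 = 0 := by simp [l']
  have hl' : ∀ k : Fin n, l' (k + 1) = l k := fun k => by simp [l']
  have hsum : ∀ F : ℕ → ℝ → ℝ, F 0 0 = 0 → ∑ k ∈ Finset.range (n + 1), F k (l' k) =
      ∑ k : Fin n, F (k + 1) (l k) := fun F hF => by
    rw [Finset.sum_range_succ', h0, hF, add_zero, Finset.sum_range]
    exact Finset.sum_congr rfl fun k _ => by rw [hl']
  refine ⟨l', h0, ?_, fun q hq hq0 => ?_, ?_⟩
  · rwa [hsum (fun _ y => |y|) abs_zero]
  · rw [hsum (fun k y => y * q.eval (k : ℝ)) (zero_mul _)]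
    refine h2 (fun k => q.eval (((k : ℕ) + 1 : ℕ) : ℝ)) (mem_devSpace.mpr ⟨q, hq, hq0, fun k => ?_⟩)
    push_cast
    rfl
  · rwa [hsum (fun _ y => y) rfl]

lemma card_filter_superset {n : ℕ} (S : Finset (Fin n)) (k : ℕ) :
    (Finset.univ.filter fun T : Finset (Fin n) => T.card = k ∧ S ⊆ T).card * n.descFactorial S.card
      = n.choose k * k.descFactorial S.card := by
  rcases lt_or_ge k S.card with hk | hk
  · have h : (Finset.univ.filter fun T : Finset (Fin n) => T.card = k ∧ S ⊆ T) = ∅ := by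
      rw [Finset.filter_eq_empty_iff]
      rintro T - ⟨rfl, hT⟩
      exact absurd (Finset.card_le_card hT) (not_le.mpr hk)
    rw [h, Finset.card_empty, zero_mul, Nat.descFactorial_eq_zero_iff_lt.mpr hk, mul_zero]
  · have hcard : (Finset.univ.filter fun T : Finset (Fin n) => T.card = k ∧ S ⊆ T).card
        = (n - S.card).choose (k - S.card) := by
      have hc : Sᶜ.card = n - S.card := by rw [Finset.card_compl, Fintype.card_fin]
      rw [← hc, ← Finset.card_powersetCard]
      refine Finset.card_bij' (fun T _ => T \ S) (fun U _ => U ∪ S) ?_ ?_ ?_ ?_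
      · intro T hT
        rw [Finset.mem_filter] at hT
        rw [Finset.mem_powersetCard, Finset.card_sdiff_of_subset hT.2.2, hT.2.1]
        exact ⟨fun x hx => Finset.mem_compl.mpr (Finset.mem_sdiff.mp hx).2, rfl⟩
      · intro U hU
        rw [Finset.mem_powersetCard] at hU
        have hdisj : Disjoint U S := Finset.disjoint_left.mpr fun x hx =>
          Finset.mem_compl.mp (hU.1 hx)
        rw [Finset.mem_filter, Finset.card_union_of_disjoint hdisj, hU.2]
        exact ⟨Finset.mem_univ _, by omega, Finset.subset_union_right⟩
      · intro T hT
        exact Finset.sdiff_union_of_subset (Finset.mem_filter.mp hT).2.2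
      · intro U hU
        have hdisj : Disjoint U S := Finset.disjoint_left.mpr fun x hx =>
          Finset.mem_compl.mp ((Finset.mem_powersetCard.mp hU).1 hx)
        exact Finset.union_sdiff_cancel_right hdisj
    have hS : S.card ≤ n := by simpa using S.card_le_univ
    rw [hcard, Nat.descFactorial_eq_factorial_mul_choose, Nat.descFactorial_eq_factorial_mul_choose]
    rcases lt_or_ge n k with hkn | hkn
    · rw [Nat.choose_eq_zero_of_lt hkn, Nat.choose_eq_zero_of_lt (by omega)]; simp
    · have := Nat.choose_mul (n := n) hk
      calc (n - S.card).choose (k - S.card) * (S.card.factorial * n.choose S.card)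
          = S.card.factorial * (n.choose S.card * (n - S.card).choose (k - S.card)) := by ring
        _ = S.card.factorial * (n.choose k * k.choose S.card) := by rw [this]
        _ = _ := by ring

/-- Symmetrization: the average of `upperIndicator S` over the sets of size `k` is a falling
factorial of `k`, a polynomial of degree `|S|` that vanishes at `0` if `S` is nonempty. -/
lemma sum_card_weights {n : ℕ} (l : ℕ → ℝ) (S : Finset (Fin n)) :
    ∑ T : Finset (Fin n), l T.card / n.choose T.card * upperIndicator S T =
      ∑ k ∈ Finset.range (n + 1), l k * (k.descFactorial S.card / n.descFactorial S.card : ℝ) := by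
  rw [← Finset.sum_fiberwise_of_maps_to (g := Finset.card) (t := Finset.range (n + 1))
    (fun T _ => Finset.mem_range.mpr (Nat.lt_succ_of_le (by simpa using T.card_le_univ)))]
  refine Finset.sum_congr rfl fun k hk => ?_
  have hkn : k ≤ n := Nat.lt_succ_iff.mp (Finset.mem_range.mp hk)
  have h1 : ∑ T with T.card = k, l T.card / n.choose T.card * upperIndicator S T =
      ∑ T : Finset (Fin n) with T.card = k ∧ S ⊆ T, l k / n.choose k := by
    rw [← Finset.filter_filter, Finset.sum_filter (fun T => S ⊆ T)]
    refine Finset.sum_congr rfl fun T hT => ?_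
    rw [(Finset.mem_filter.mp hT).2, upperIndicator, mul_ite, mul_one, mul_zero]
  rw [h1, Finset.sum_const, nsmul_eq_mul]
  have h2 := card_filter_superset S k
  have h3 : (0 : ℝ) < n.choose k := by exact_mod_cast Nat.choose_pos hkn
  have h4 : (0 : ℝ) < n.descFactorial S.card := by
    exact_mod_cast Nat.pos_of_ne_zero fun h => by
      have := Nat.descFactorial_eq_zero_iff_lt.mp h
      have hS : S.card ≤ n := by simpa using S.card_le_univ
      omega
  have h5 : ((Finset.univ.filter fun T : Finset (Fin n) => T.card = k ∧ S ⊆ T).card : ℝ) *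
      n.descFactorial S.card = n.choose k * k.descFactorial S.card := by exact_mod_cast h2
  field_simp
  linear_combination l k * h5

/-- A signed weight that certifies the lower bound `minDev n d` for the approximation of `1` by
coefficients of low degree. -/
lemma exists_dual_lowDegree (n d : ℕ) : ∃ μ : Finset (Fin n) → ℝ, μ ∅ = 0 ∧ ∑ T, |μ T| ≤ 1 ∧
    (∀ c ∈ lowDegree n d, ∑ T, μ T * c T = 0) ∧ ∑ T, μ T = minDev n d := by
  obtain ⟨l, h0, h1, h2, h3⟩ := exists_dual_weights n d
  refine ⟨fun T => l T.card / n.choose T.card, by simp [h0], ?_, fun c hc => ?_, ?_⟩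
  · have := sum_card_weights (fun k => |l k|) (∅ : Finset (Fin n))
    simp only [upperIndicator_empty, Pi.one_apply, mul_one, Finset.card_empty,
      Nat.descFactorial_zero, Nat.cast_one, div_one] at this
    simpa only [abs_div, Nat.abs_cast, this] using h1
  · induction hc using Submodule.span_induction with
    | mem c hc =>
      obtain ⟨S, ⟨hS, hSd⟩, rfl⟩ := hc
      rw [sum_card_weights]
      have := h2 (C (n.descFactorial S.card : ℝ)⁻¹ * descPochhammer ℝ S.card)
        ((natDegree_C_mul_le _ _).trans ((descPochhammer_natDegree ℝ _).trans_le hSd)) (by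
          rw [eval_mul, descPochhammer_ne_zero_eval_zero _ hS.card_pos.ne', mul_zero])
      rw [← this]
      refine Finset.sum_congr rfl fun k _ => ?_
      rw [eval_mul, eval_C, descPochhammer_eval_eq_descFactorial, div_eq_inv_mul]
    | zero => simp
    | add x y _ _ hx hy => simp only [Pi.add_apply, mul_add, Finset.sum_add_distrib, hx, hy, add_zero]
    | smul a x _ hx =>
      simp only [Pi.smul_apply, smul_eq_mul, mul_left_comm _ a, ← Finset.mul_sum, hx, mul_zero]
  · have := sum_card_weights l (∅ : Finset (Fin n))
    simp only [upperIndicator_empty, Pi.one_apply, mul_one, Finset.card_empty,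
      Nat.descFactorial_zero, Nat.cast_one, div_one] at this
    rw [this, h3]

/-- As `μ` annihilates `c`, `minDev n d = ∑ μ (1 - c) ≤ ∑ |μ| |c - 1|`; Cauchy-Schwarz with total
mass at most `1` gives the square. -/
lemma minDev_sq_le_sum {n d : ℕ} {μ c : Finset (Fin n) → ℝ} (h1 : ∑ T, |μ T| ≤ 1)
    (h2 : ∑ T, μ T * c T = 0) (h3 : ∑ T, μ T = minDev n d) :
    minDev n d ^ 2 ≤ ∑ T, (c T - 1) ^ 2 * |μ T| := by
  have h4 : minDev n d ≤ ∑ T, |μ T| * |c T - 1| := by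
    calc minDev n d = -∑ T, μ T * (c T - 1) := by
          simp only [mul_sub, mul_one, Finset.sum_sub_distrib, h2, h3]; ring
      _ ≤ |∑ T, μ T * (c T - 1)| := neg_le_abs _
      _ ≤ ∑ T, |μ T * (c T - 1)| := Finset.abs_sum_le_sum_abs _ _
      _ = _ := Finset.sum_congr rfl fun T _ => abs_mul _ _
  have h5 := Finset.sum_mul_sq_le_sq_mul_sq Finset.univ (fun T => √|μ T|)
    fun T => √|μ T| * |c T - 1|
  have e1 : ∀ T, √|μ T| * (√|μ T| * |c T - 1|) = |μ T| * |c T - 1| := fun T => by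
    rw [← mul_assoc, Real.mul_self_sqrt (abs_nonneg _)]
  have e2 : ∀ T, (√|μ T| * |c T - 1|) ^ 2 = (c T - 1) ^ 2 * |μ T| := fun T => by
    rw [mul_pow, Real.sq_sqrt (abs_nonneg _), sq_abs, mul_comm]
  simp only [e1, e2, Real.sq_sqrt (abs_nonneg _)] at h5
  have h6 : 0 ≤ ∑ T, (c T - 1) ^ 2 * |μ T| := Finset.sum_nonneg fun T _ => by positivity
  calc minDev n d ^ 2 ≤ (∑ T, |μ T| * |c T - 1|) ^ 2 := by
        have := minDev_nonneg n d
        gcongr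
    _ ≤ (∑ T, |μ T|) * ∑ T, (c T - 1) ^ 2 * |μ T| := h5
    _ ≤ 1 * ∑ T, (c T - 1) ^ 2 * |μ T| := by gcongr
    _ = _ := one_mul _

lemma Prior.lintegral_sub_target_sq {n : ℕ} (D : Prior n) {f : Signals n → ℝ}
    {c : Finset (Fin n) → ℝ} (hf : f =ᵐ[D.law] linForm c) :
    ∫⁻ x, ENNReal.ofReal ((f x - target x) ^ 2) ∂D.law =
      ENNReal.ofReal (∑ T, (c T - 1) ^ 2 * variance (fun x : ℝ => x) (D.dist T)) := by
  have := D.lintegral_linForm_sq (c - 1)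
  simp only [Pi.sub_apply, Pi.one_apply] at this
  rw [← this]
  refine lintegral_congr_ae ?_
  filter_upwards [hf] with x hx
  have e : linForm (c - 1) x = linForm c x - target x := by
    rw [target_eq_linForm, eq_sub_iff_add_eq, ← linForm_add, sub_add_cancel]
  rw [hx, e]

/-- The bad prior gives `X_T` the variance `|μ T|`. It does not depend on the rule, so the bound
holds for each draw and survives averaging over the randomization. -/
theorem minDev_sq_le_worstError {n d : ℕ} {Z : RandomContext} {A : Approximator n Z}
    (hA : A ∈ linApproximators n d Z) : ENNReal.ofReal (minDev n d ^ 2) ≤ worstError A := by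
  obtain ⟨R, hRA, hR⟩ := hA
  obtain ⟨μ, hμ0, hμ1, hμ2, hμ3⟩ := exists_dual_lowDegree n d
  -- If `minDev n d = 0`, then `μ` may vanish and define no prior, but the claim is trivial.
  rcases (minDev_nonneg n d).eq_or_lt with hM | hM
  · rw [← hM]; simp
  have hne : ∃ T, √|μ T| ≠ 0 := by
    by_contra! hcon
    have : ∀ T, μ T = 0 := fun T => by
      simpa [Real.sqrt_eq_zero (abs_nonneg _)] using hcon T
    simp [this] at hμ3
    exact hM.ne hμ3
  set D := symmPrior (fun T => √|μ T|) (by simp [hμ0]) hne with hD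
  have hvar : ∀ T, variance (fun x : ℝ => x) (D.dist T) = |μ T| := fun T => by
    change variance _ (twoPoint _) = _
    rw [variance_twoPoint, Real.sq_sqrt (abs_nonneg _)]
  have hloss : ENNReal.ofReal (minDev n d ^ 2) ≤ loss A D := by
    have h1 : loss A D = ∫⁻ p, ENNReal.ofReal (((R.rule p.1).output D p.2 - target p.2) ^ 2)
        ∂(Z.P.prod D.law) := by
      refine lintegral_congr_ae ?_
      filter_upwards [hRA D] with p hp
      rw [hp]
    have hmeas : Measurable fun p : Z.Ω × Signals n =>
        ENNReal.ofReal (((R.rule p.1).output D p.2 - target p.2) ^ 2) :=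
      (((R.measurable_output D).sub (measurable_target.comp measurable_snd)).pow_const 2).ennreal_ofReal
    rw [h1, lintegral_prod _ hmeas.aemeasurable]
    calc ENNReal.ofReal (minDev n d ^ 2) = ∫⁻ _, ENNReal.ofReal (minDev n d ^ 2) ∂Z.P := by simp
      _ ≤ _ := by
        refine lintegral_mono_ae ?_
        filter_upwards [hR] with z hz
        obtain ⟨c, hc, hout⟩ := hz.1.exists_output_eq_linForm hz.2.1
        rw [D.lintegral_sub_target_sq (hout D)]
        simp only [hvar]
        exact ENNReal.ofReal_le_ofReal (minDev_sq_le_sum hμ1 (hμ2 c hc) hμ3)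
  refine le_trans ?_ (le_iSup _ D)
  have hpos : 0 < ∑ T, |μ T| := by
    obtain ⟨T, hT⟩ := hne
    refine Finset.sum_pos' (fun _ _ => abs_nonneg _) ⟨T, Finset.mem_univ _, ?_⟩
    exact Real.sqrt_ne_zero'.mp hT
  simp only [hvar]
  rw [ENNReal.le_div_iff_mul_le (Or.inl (by simpa using hpos)) (Or.inl ENNReal.ofReal_ne_top)]
  calc _ ≤ ENNReal.ofReal (minDev n d ^ 2) * 1 := by
        gcongr
        exact ENNReal.ofReal_le_one.mpr hμ1
    _ ≤ _ := by rw [mul_one]; exact hloss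

end LowerBound

/-! ### The optimal aggregation rule -/

section UpperBound

variable {n : ℕ}

/-- The query put to expert `i` whose answer is the observed part of the linear form `b`. -/
def linQuery (i : Fin n) (b : Finset (Fin n) → ℝ) : Query n where
  agent := i
  answer _ s := ∑ T : {T : Finset (Fin n) // i ∈ T}, b T * s T
  measurable_answer _ := by fun_prop

lemma linQuery_out (i : Fin n) (b : Finset (Fin n) → ℝ) (D : Prior n) :
    (linQuery i b).out D = linForm (restrictTo i b) := by
  funext x
  rw [linForm_restrictTo]
  rfl

lemma integral_sub_sq_lt {Ω : Type*} [MeasurableSpace Ω] {ν : Measure Ω} [IsProbabilityMeasure ν]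
    {f : Ω → ℝ} (hf : Integrable f ν) (hf2 : Integrable (fun z => f z ^ 2) ν) {r : ℝ}
    (hr : r ≠ ∫ z, f z ∂ν) :
    ∫ z, -(r - f z) ^ 2 ∂ν < ∫ z, -((∫ z, f z ∂ν) - f z) ^ 2 ∂ν := by
  have h : ∀ a : ℝ, ∫ z, -(a - f z) ^ 2 ∂ν = -a ^ 2 + 2 * a * (∫ z, f z ∂ν) - ∫ z, f z ^ 2 ∂ν := by
    intro a
    have e : (fun z => -(a - f z) ^ 2) = fun z => (-a ^ 2 + 2 * a * f z) - f z ^ 2 := by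
      funext z; ring
    have hi : Integrable (fun z => -a ^ 2 + 2 * a * f z) ν :=
      (integrable_const _).add (hf.const_mul _)
    rw [e, integral_sub hi hf2, integral_add (integrable_const _) (hf.const_mul _),
      integral_const_mul]
    simp
  rw [h, h]
  have := sq_pos_of_ne_zero (sub_ne_zero.mpr hr)
  nlinarith

/-- The conditional expectation of a linear form is elicitable by the quadratic scoring rule. -/
lemma elicitable_linQuery {κ : Type} [Countable κ] {R : κ → Prior n → Signals n → ℝ}
    (hR : ∀ v D, Measurable (R v D)) (i : Fin n) {b : Finset (Fin n) → ℝ} (v₀ : κ)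
    (hv₀ : ∀ D, R v₀ D = linForm b) : Elicitable (linQuery i b) R := by
  refine ⟨fun r z => -(r - z v₀) ^ 2, fun D => ?_⟩
  have hobs : Measurable (observe (n := n) i) := measurable_observe i
  have hY : Measurable fun y v => R v D y := measurable_pi_lambda _ fun v => hR v D
  have hR₀ : (fun x => R v₀ D x) = linForm b := hv₀ D
  have h1 := condExp_ae_eq_integral_condDistrib (μ := D.law) hobs hY.aemeasurable
    (f := fun z : κ → ℝ => z v₀) (measurable_pi_apply v₀).stronglyMeasurable (by
      simpa only [hR₀] using D.integrable_linForm b)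
  have h2 := D.condExp_linForm i b
  simp only [hR₀] at h1
  have hint : ∀ g : ℝ → ℝ, Measurable g → Integrable (fun x => g (linForm b x)) D.law →
      ∀ᵐ x ∂D.law, Integrable (fun z : κ → ℝ => g (z v₀))
        (condDistrib (fun y v => R v D y) (observe i) D.law (observe i x)) := by
    intro g hg hgi
    refine Integrable.condDistrib_ae (f := fun p : AgentSignals i × (κ → ℝ) => g (p.2 v₀))
      hobs.aemeasurable hY.aemeasurable ?_
    rw [integrable_map_measure (by
      exact (hg.comp ((measurable_pi_apply v₀).comp measurable_snd)).aestronglyMeasurable)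
      (hobs.prodMk hY).aemeasurable]
    have e : (fun p : AgentSignals i × (κ → ℝ) => g (p.2 v₀)) ∘
        (fun a => (observe i a, fun v => R v D a)) = fun x => g (linForm b x) := by
      funext x
      simp [hv₀]
    rw [e]
    exact hgi
  filter_upwards [h1, h2, hint id measurable_id (D.integrable_linForm b),
    hint (fun y => y ^ 2) (by fun_prop) (D.memLp_linForm b).integrable_sq] with x hx1 hx2 hx3 hx4
  have hout : (linQuery i b).out D x =
      ∫ z, z v₀ ∂(condDistrib (fun y v => R v D y) (observe i) D.law (observe i x)) := by
    rw [linQuery_out, ← hx2, hx1]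
  refine ⟨fun r => ?_, fun r hr => ?_⟩
  · have e : (fun z : κ → ℝ => -(r - z v₀) ^ 2) =
        fun z => (-r ^ 2 + 2 * r * z v₀) - z v₀ ^ 2 := by
      funext z; ring
    rw [e]
    exact ((integrable_const _).add (hx3.const_mul _)).sub hx4
  · rw [hout] at hr ⊢
    exact integral_sub_sq_lt hx3 hx4 hr

/-- The nonempty sets of at most `d` experts. -/
abbrev SmallSet (n d : ℕ) : Type := {S : Finset (Fin n) // S.Nonempty ∧ S.card ≤ d}

/-- The set of experts of a node of the graph of nested queries. -/
noncomputable def nodeSet (n d : ℕ) : Option (Fin (Fintype.card (SmallSet n d))) → Finset (Fin n)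
  | some j => ((Fintype.equivFin (SmallSet n d)).symm j).1
  | none => ∅

lemma nodeSet_injective (n d : ℕ) : Function.Injective (nodeSet n d) := by
  rintro (_ | j) (_ | k) h
  · rfl
  · exact absurd h.symm ((Fintype.equivFin (SmallSet n d)).symm k).2.1.ne_empty
  · exact absurd h ((Fintype.equivFin (SmallSet n d)).symm j).2.1.ne_empty
  · exact congrArg some ((Fintype.equivFin (SmallSet n d)).symm.injective (Subtype.ext h))

lemma nodeSet_some_nonempty {d : ℕ} (j : Fin (Fintype.card (SmallSet n d))) :
    (nodeSet n d (some j)).Nonempty := ((Fintype.equivFin (SmallSet n d)).symm j).2.1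

lemma card_nodeSet_le {d : ℕ} (v) : (nodeSet n d v).card ≤ d := by
  cases v with
  | none => exact Nat.zero_le _
  | some j => exact ((Fintype.equivFin (SmallSet n d)).symm j).2.2

lemma exists_nodeSet_eq {d : ℕ} {S : Finset (Fin n)} (hS : S.card ≤ d) :
    ∃ v, nodeSet n d v = S := by
  rcases S.eq_empty_or_nonempty with rfl | hne
  · exact ⟨none, rfl⟩
  · exact ⟨some (Fintype.equivFin (SmallSet n d) ⟨S, hne, hS⟩), by simp [nodeSet]⟩

/-- The expert who is asked for a forecast of the forecast of the other experts of the set. -/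
noncomputable def nestedAgent {d : ℕ} (j : Fin (Fintype.card (SmallSet n d))) : Fin n :=
  (nodeSet n d (some j)).min' (nodeSet_some_nonempty j)

lemma nestedAgent_mem {d : ℕ} (j : Fin (Fintype.card (SmallSet n d))) :
    nestedAgent j ∈ nodeSet n d (some j) := Finset.min'_mem _ _

/-- The nested forecasts: each expert of a small set in turn is asked for the expectation of the
forecast of the next one. -/
noncomputable def nestedQuery (n d : ℕ) (j : Fin (Fintype.card (SmallSet n d))) : Query n :=
  linQuery (nestedAgent j) (upperIndicator ((nodeSet n d (some j)).erase (nestedAgent j)))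

/-- The graph of the nested forecasts. -/
noncomputable def nestedGraph (n d : ℕ) : Digraph (Option (Fin (Fintype.card (SmallSet n d)))) where
  Adj v w := ∃ j, v = some j ∧ nodeSet n d w = (nodeSet n d v).erase (nestedAgent j)

lemma nodeVar_nestedQuery (d : ℕ) (v) (D : Prior n) :
    nodeVar (nestedQuery n d) v D = linForm (upperIndicator (nodeSet n d v)) := by
  cases v with
  | none =>
    change target = _
    rw [target_eq_linForm, nodeSet, upperIndicator_empty]
  | some j =>
    change (linQuery _ _).out D = _
    rw [linQuery_out, restrictTo_upperIndicator, Finset.insert_erase (nestedAgent_mem j)]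

lemma nestedGraph_adj_some {d : ℕ} {j} {w} : (nestedGraph n d).Adj (some j) w ↔
    nodeSet n d w = (nodeSet n d (some j)).erase (nestedAgent j) :=
  ⟨fun ⟨_, hk, h⟩ => by obtain rfl := Option.some.inj hk; exact h, fun h => ⟨j, rfl, h⟩⟩

lemma exists_nestedGraph_adj {d : ℕ} (j : Fin (Fintype.card (SmallSet n d))) :
    ∃ w, (nestedGraph n d).Adj (some j) w ∧ ∀ w', (nestedGraph n d).Adj (some j) w' → w' = w := by
  obtain ⟨w, hw⟩ := exists_nodeSet_eq (d := d) (S := (nodeSet n d (some j)).erase (nestedAgent j))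
    ((Finset.card_erase_le).trans (card_nodeSet_le _))
  refine ⟨w, nestedGraph_adj_some.mpr hw, fun w' hw' => nodeSet_injective n d ?_⟩
  rw [nestedGraph_adj_some.mp hw', hw]

lemma card_nodeSet_of_adj {d : ℕ} {v w} (h : (nestedGraph n d).Adj v w) :
    (nodeSet n d w).card + 1 = (nodeSet n d v).card ∧ nodeSet n d w ⊆ nodeSet n d v := by
  obtain ⟨j, rfl, h⟩ := h
  rw [h]
  exact ⟨Finset.card_erase_add_one (nestedAgent_mem j), Finset.erase_subset _ _⟩

lemma card_nodeSet_lt_of_transGen {d : ℕ} {v w} (h : Relation.TransGen (nestedGraph n d).Adj v w) :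
    (nodeSet n d w).card < (nodeSet n d v).card := by
  induction h with
  | single h => have := (card_nodeSet_of_adj h).1; omega
  | tail _ h ih => have := (card_nodeSet_of_adj h).1; omega

lemma nodeSet_subset_of_reflTransGen {d : ℕ} {v w}
    (h : Relation.ReflTransGen (nestedGraph n d).Adj v w) : nodeSet n d w ⊆ nodeSet n d v := by
  induction h with
  | refl => exact subset_rfl
  | tail _ h ih => exact (card_nodeSet_of_adj h).2.trans ih

lemma dagElicits_nested (n d : ℕ) : DAGElicits (nestedQuery n d) (nestedGraph n d) := by
  refine ⟨fun v hv => (card_nodeSet_lt_of_transGen hv).false, fun v => ⟨fun h => ?_, ?_⟩, fun j => ?_⟩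
  · cases v with
    | none => rfl
    | some j =>
      obtain ⟨w, hw, -⟩ := exists_nestedGraph_adj j
      exact absurd hw (h w)
  · rintro rfl w ⟨j, hj, -⟩
    exact Option.some_ne_none j hj.symm
  · obtain ⟨w, hw, -⟩ := exists_nestedGraph_adj j
    have h := elicitable_linQuery (n := n) (κ := {v // (nestedGraph n d).Adj (some j) v})
      (R := fun v => nodeVar (nestedQuery n d) v.1)
      (fun v D => measurable_nodeVar (nestedQuery n d) v.1 D) (nestedAgent j)
      (b := upperIndicator ((nodeSet n d (some j)).erase (nestedAgent j))) ⟨w, hw⟩ fun D => by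
        rw [nodeVar_nestedQuery, nestedGraph_adj_some.mp hw]
    exact h

lemma agentComplexity_nestedQuery_le (n d : ℕ) : agentComplexity (nestedQuery n d) ≤ d := by
  refine iInf₂_le_of_le (nestedGraph n d) (dagElicits_nested n d) (iSup_le fun j => ?_)
  calc (relevantAgents (nestedQuery n d) (nestedGraph n d) j).encard
      ≤ ((nodeSet n d (some j) : Finset (Fin n)) : Set (Fin n)).encard := by
        refine Set.encard_le_encard ?_
        rintro i ⟨k, hk, rfl⟩
        exact nodeSet_subset_of_reflTransGen hk (nestedAgent_mem k)
    _ ≤ d := by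
        rw [Set.encard_coe_eq_coe_finsetCard]
        exact_mod_cast card_nodeSet_le (some j)

lemma orderComplexity_nestedQuery_le (n d : ℕ) : orderComplexity (nestedQuery n d) ≤ d := by
  refine iInf₂_le_of_le (nestedGraph n d) (dagElicits_nested n d) (iSup_le fun j => sSup_le ?_)
  rintro _ ⟨l, w, rfl, hw0, -, hadj⟩
  -- Each edge removes exactly one expert, so the length of a path is at most the size of its
  -- initial set.
  have h : ∀ i ≤ l, (nodeSet n d (w i)).card + i = (nodeSet n d (w 0)).card := by
    intro i hi
    induction i with
    | zero => rfl
    | succ i ih =>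
      have h1 := (card_nodeSet_of_adj (hadj i (by omega))).1
      have h2 := ih (by omega)
      omega
  have h1 := h l le_rfl
  have h2 := card_nodeSet_le (n := n) (d := d) (w 0)
  exact_mod_cast (by omega : l ≤ d)

/-- The aggregation rule that combines the nested forecasts, weighted by the number of experts. -/
noncomputable def nestedRule (n d : ℕ) (b : ℕ → ℝ) : AggregationRule n where
  size := Fintype.card (SmallSet n d)
  query := nestedQuery n d
  aggregate y := ∑ j, b (nodeSet n d (some j)).card * y j

open Classical in
lemma nestedQuery_out_ae_eq_condExp (n d : ℕ) (j : Fin (Fintype.card (SmallSet n d)))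
    (D : Prior n) : (nestedQuery n d j).out D =ᵐ[D.law]
      (D.law)[fun x => ∑ v with (nestedGraph n d).Adj (some j) v,
        (1 : ℝ) * nodeVar (nestedQuery n d) v D x | agentSigma (nestedAgent j)] := by
  obtain ⟨w, hw, huniq⟩ := exists_nestedGraph_adj (n := n) (d := d) j
  have hfilter : (Finset.univ.filter fun v => (nestedGraph n d).Adj (some j) v) = {w} := by
    ext v
    rw [Finset.mem_filter, Finset.mem_singleton]
    exact ⟨fun h => huniq v h.2, fun h => ⟨Finset.mem_univ _, h ▸ hw⟩⟩
  have e : (fun x => ∑ v with (nestedGraph n d).Adj (some j) v,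
      (1 : ℝ) * nodeVar (nestedQuery n d) v D x) =
      linForm (upperIndicator ((nodeSet n d (some j)).erase (nestedAgent j))) := by
    funext x
    rw [hfilter, Finset.sum_singleton, one_mul, nodeVar_nestedQuery, nestedGraph_adj_some.mp hw]
  rw [e, nestedQuery, linQuery_out]
  exact (D.condExp_linForm _ _).symm

lemma isLinear_nestedRule (n d : ℕ) (b : ℕ → ℝ) : (nestedRule n d b).IsLinear :=
  ⟨⟨nestedGraph n d, dagElicits_nested n d, fun _ _ => 1, nestedQuery_out_ae_eq_condExp n d⟩,
    _, fun _ => rfl⟩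

lemma nestedRule_output (n d : ℕ) (b : ℕ → ℝ) (D : Prior n) : (nestedRule n d b).output D =
    linForm (∑ j, b (nodeSet n d (some j)).card • upperIndicator (nodeSet n d (some j))) := by
  funext x
  have h : ∀ j, linForm (b (nodeSet n d (some j)).card • upperIndicator (nodeSet n d (some j))) x =
      b (nodeSet n d (some j)).card * (nestedQuery n d j).out D x := fun j => by
    rw [linForm_smul, ← nodeVar_nestedQuery d (some j) D]
    rfl
  simp only [linForm_sum, h]
  rfl

lemma sum_nodeSet (n d : ℕ) (F : Finset (Fin n) → ℝ) :
    ∑ j, F (nodeSet n d (some j)) = ∑ S with S.Nonempty ∧ S.card ≤ d, F S := by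
  have h := Finset.sum_subtype (F := inferInstanceAs (Fintype (SmallSet n d))) (p := fun S : Finset (Fin n) => S.Nonempty ∧ S.card ≤ d)
    (Finset.univ.filter fun S => S.Nonempty ∧ S.card ≤ d) (by simp) F
  rw [h]
  exact (Fintype.equivFin (SmallSet n d)).symm.sum_comp fun S => F S.1

open Polynomial in
-- Newton's forward difference formula at `|T|`: the binomial coefficient counts the subsets of `T`
-- of a given size, and the differences of order `0` and above `d` vanish.
lemma sum_fwdDiff_eq_eval {q : ℝ[X]} {d : ℕ} (hq : q.natDegree ≤ d) (h0 : q.eval 0 = 0)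
    (T : Finset (Fin n)) :
    ∑ S with S.Nonempty ∧ S.card ≤ d, (fwdDiff (1 : ℝ))^[S.card] q.eval 0 * upperIndicator S T
      = q.eval (T.card : ℝ) := by
  have h1 := shift_eq_sum_fwdDiff_iter (1 : ℝ) q.eval T.card 0
  rw [zero_add, nsmul_eq_mul, mul_one] at h1
  have h2 : ∑ k ∈ Finset.range (T.card + 1), T.card.choose k • (fwdDiff (1 : ℝ))^[k] q.eval 0 =
      ∑ S ∈ T.powerset, (fwdDiff (1 : ℝ))^[S.card] q.eval 0 :=
    (Finset.sum_powerset_apply_card (fun k => (fwdDiff (1 : ℝ))^[k] q.eval 0)).symm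
  rw [h1, h2]
  have h3 : ∀ S : Finset (Fin n), ¬ (S.Nonempty ∧ S.card ≤ d) →
      (fwdDiff (1 : ℝ))^[S.card] q.eval 0 = 0 := by
    intro S hS
    rcases S.eq_empty_or_nonempty with rfl | hne
    · simpa using h0
    · have : q.natDegree < S.card := by
        by_contra hcon
        exact hS ⟨hne, by omega⟩
      rw [Polynomial.fwdDiff_iter_eq_zero_of_degree_lt this]
      rfl
  have h4 : T.powerset = Finset.univ.filter (· ⊆ T) := by ext; simp
  rw [h4, Finset.sum_filter, Finset.sum_filter]
  refine Finset.sum_congr rfl fun S _ => ?_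
  by_cases hS : S.Nonempty ∧ S.card ≤ d
  · simp [hS, upperIndicator]
  · simp [hS, h3 S hS]

/-- The trivial random context. -/
noncomputable def trivialContext : RandomContext where
  Ω := Unit
  P := Measure.dirac ()

/-- A deterministic aggregation rule as a randomized one. -/
noncomputable def AggregationRule.toRandomized (R : AggregationRule n)
    (hR : ∀ D, Measurable (R.output D)) : RandomizedRule n trivialContext where
  rule _ := R
  measurable_output D := (hR D).comp measurable_snd

/-- For an extremal `p`, nested forecasts realize the coefficient `1 - p(|T|)` of `X_T`, so the loss
is `∑ p(|T|)² Var X_T`; `T = ∅`, where `p = 1`, does not count because `X_∅ = 0`. -/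
theorem exists_worstError_le (n d : ℕ) : ∃ (Z : RandomContext) (A : Approximator n Z),
    A ∈ linApproximators n d Z ∧ worstError A ≤ ENNReal.ofReal (minDev n d ^ 2) := by
  obtain ⟨p, hpd, hp0, hp⟩ := exists_minDev n d
  set q := 1 - p with hq
  set R := nestedRule n d fun k => (fwdDiff (1 : ℝ))^[k] q.eval 0 with hR
  have hout : ∀ D, R.output D = linForm fun T => q.eval (T.card : ℝ) := by
    intro D
    rw [hR, nestedRule_output]
    congr 1
    funext T
    rw [Finset.sum_apply, ← sum_fwdDiff_eq_eval (q := q) (d := d)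
      ((Polynomial.natDegree_sub_le _ _).trans (by simpa using hpd)) (by simp [hq, hp0]) T]
    exact sum_nodeSet n d fun S => (fwdDiff (1 : ℝ))^[S.card] q.eval 0 * upperIndicator S T
  have hmeas : ∀ D, Measurable (R.output D) := fun D => by
    rw [hout]; exact measurable_linForm _
  refine ⟨trivialContext, fun D p => R.output D p.2, ⟨R.toRandomized hmeas, fun D =>
    Eventually.of_forall fun _ => rfl, Eventually.of_forall fun _ => ⟨isLinear_nestedRule n d _,
    agentComplexity_nestedQuery_le n d, orderComplexity_nestedQuery_le n d⟩⟩, iSup_le fun D => ?_⟩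
  refine ENNReal.div_le_of_le_mul ?_
  have h1 : loss (Z := trivialContext) (fun D p => R.output D p.2) D =
      ENNReal.ofReal (∑ T, (q.eval (T.card : ℝ) - 1) ^ 2 * variance (fun x : ℝ => x) (D.dist T)) := by
    have hm : Measurable fun p : trivialContext.Ω × Signals n =>
        ENNReal.ofReal ((R.output D p.2 - target p.2) ^ 2) :=
      ((((hmeas D).comp measurable_snd).sub
        (measurable_target.comp measurable_snd)).pow_const 2).ennreal_ofReal
    rw [loss, lintegral_prod _ hm.aemeasurable]
    simp only
    rw [D.lintegral_sub_target_sq (Eventually.of_forall fun x => congrFun (hout D) x)]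
    simp
  rw [h1, ← ENNReal.ofReal_mul (by positivity), Finset.mul_sum]
  refine ENNReal.ofReal_le_ofReal (Finset.sum_le_sum fun T _ => ?_)
  rcases T.eq_empty_or_nonempty with rfl | hT
  · have : variance (fun x : ℝ => x) (D.dist ∅) = 0 := by
      rw [D.dist_empty, ← twoPoint_zero, variance_twoPoint, sq, zero_mul]
    simp [this]
  · have h2 := hp T.card hT.card_pos (by simpa using T.card_le_univ)
    have e : q.eval (T.card : ℝ) - 1 = -p.eval (T.card : ℝ) := by
      simp [hq]
    rw [e, neg_sq, ← sq_abs]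
    have := variance_nonneg (fun x : ℝ => x) (D.dist T)
    gcongr

theorem optimalError_eq (n d : ℕ) : optimalError n d = ENNReal.ofReal (minDev n d ^ 2) := by
  refine le_antisymm ?_ (le_iInf fun Z => le_iInf₂ fun A hA => minDev_sq_le_worstError hA)
  obtain ⟨Z, A, hA, hle⟩ := exists_worstError_le n d
  exact (iInf_le_of_le Z (iInf₂_le_of_le A hA hle))

end UpperBound

theorem mainTheorem1 :
    -- the best worst-case error is a minimum, and it is finite
    (∀ n d : ℕ, optimalError n d ≠ ∞ ∧
      ∃ (Z : RandomContext) (A : Approximator n Z),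
        A ∈ linApproximators n d Z ∧ worstError A = optimalError n d) ∧
    -- d = o(√n)
    (∀ d : ℕ → ℕ, (fun n : ℕ => (d n : ℝ)) =o[atTop] (fun n : ℕ => √(n : ℝ)) →
      (fun n : ℕ => 1 - (optimalError n (d n)).toReal) =Θ[atTop]
        (fun n : ℕ => (d n : ℝ) ^ 2 / (n : ℝ))) ∧
    -- d = Θ(√n)
    (∀ d : ℕ → ℕ, (fun n : ℕ => (d n : ℝ)) =Θ[atTop] (fun n : ℕ => √(n : ℝ)) →
      ∃ a b : ℝ, 0 < a ∧ b < 1 ∧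
        ∀ᶠ n : ℕ in atTop, (optimalError n (d n)).toReal ∈ Set.Icc a b) ∧
    (∀ (d : ℕ → ℕ) (c : ℝ), 0 < c →
      Tendsto (fun n : ℕ => (d n : ℝ) / √(n : ℝ)) atTop (𝓝 c) →
      ∃ l ∈ Set.Ioo (0 : ℝ) 1,
        Tendsto (fun n : ℕ => (optimalError n (d n)).toReal) atTop (𝓝 l)) ∧
    -- d = ω(√n)
    (∀ d : ℕ → ℕ, (fun n : ℕ => √(n : ℝ)) =o[atTop] (fun n : ℕ => (d n : ℝ)) →
      (fun n : ℕ => (optimalError n (d n)).toReal) =O[atTop]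
        (fun n : ℕ => Real.exp (-4 * (d n : ℝ) / √(n : ℝ)))) := by
  have h : ∀ n d, (optimalError n d).toReal = minDev n d ^ 2 := fun n d => by
    rw [optimalError_eq, ENNReal.toReal_ofReal (sq_nonneg _)]
  simp only [h]
  refine ⟨fun n d => ⟨by rw [optimalError_eq]; exact ENNReal.ofReal_ne_top, ?_⟩,
    fun d => isTheta_one_sub_minDev_sq, fun d => minDev_sq_mem_Icc_of_isTheta,
    fun d c => exists_tendsto_minDev_sq, fun d _ => isBigO_minDev_sq d⟩
  obtain ⟨Z, A, hA, hle⟩ := exists_worstError_le n d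
  refine ⟨Z, A, hA, le_antisymm (hle.trans_eq (optimalError_eq n d).symm) ?_⟩
  exact iInf_le_of_le Z (iInf₂_le_of_le A hA le_rfl)
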